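/- \textbf{Setting.} Let $p\ge 2$ be even. For $N\ge 1$ let $v_{\rm sig}\in\mathbb R^N$ be a random vector (of arbitrary law) with $|v_{\rm sig}|=\sqrt N$, and let $G$ be an independent random tensor of order $p$ and dimension $N$ whose entries are i.i.d. Gaussian: either standard real Gaussians (real ensemble), or complex with independent real and imaginary parts of mean $0$ and variance $1/2$ (complex ensemble). In either case $G$ may in addition be symmetrized, i.e. replaced by the average of its $p!$ index permutations. Let $T_0=\lambda v_{\rm sig}^{\otimes p}+G$. For an integer $n=n_{\rm bos}$ and a tensor $T$ of order $p$, define the Hermitian operator on $(\mathbb C^N)^{\otimes n}$ $$H(T)=\frac12\sum_{i_1,\dots,i_{p/2}}\Bigl(\sum_{\mu_1,\dots,\mu_p}T_{\mu_1,\dots,\mu_p}\,|\mu_1\rangle_{i_1}\langle\mu_{1+p/2}|\otimes\cdots\otimes|\mu_{p/2}\rangle_{i_{p/2}}\langle\mu_p|+{\rm h.c.}\Bigr),$$ the outer sum being over tuples of distinct $i_1,\dots,i_{p/2}\in\{1,\dots,n\}$ and $|\mu\rangle_i\langle\nu|$ denoting $|\mu\rangle\langle\nu|$ acting on the $i$-th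 tensor factor. Put $$J=c\,\frac{(p/2)!\binom{n}{p/2}}{n^{p/2}}\prod_{j=1}^{p/2}\frac{N+n-j}{N},\qquad c=1\text{ (real ensemble)},\quad c=2\text{ (complex ensemble)},$$ so that $J=c\,(p/2)!\binom{n}{p/2}/n^{p/2}+o(1)$ if $n=o(N)$. Let $$E_0=\overline\lambda\,(p/2)!\binom{n}{p/2}N^{p/2},\qquad E_{max}=\sqrt{2J\log N}\;n^{p/4+1/2}N^{p/4}.$$ The detection step of the spectral algorithm, on input $(T,\overline\lambda,n)$, computes the largest eigenvalue $\lambda_1$ of $H(T)$, either on the full space $(\mathbb C^N)^{\otimes n}$ or on its symmetric subspace, and reports "$\lambda=\overline\lambda$" if $\lambda_1>E_{cut}:=(E_0+E_{max})/2$; otherwise it reports "$\lambda=0$". \textbf{Theorem.} For every even $p\ge2$ there is a constant $\theta>0$, depending only on $p$, such that the following holds for each of the above ensembles, for $\lambda_1$ taken on the full space or on the symmetric subspace, and for every $\theta'>p/4$. Let $n=n_{\rm bos}(N)$ and $\overline\lambda=\overline\lambda(N)$ satisfy, as $N\to\infty$, $$n=O(N^\theta),\qquad \overline\lambda=\Omega(N^{-\theta'}),\qquad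 \overline\lambda=O(N^{-p/4}),$$ and $$\overline\lambda\,(p/2)!\binom{n}{p/2}N^{p/2}-E_{max}=\omega\!\left(\frac{\sqrt J\,n^{p/4-1/2}N^{p/4}}{\sqrt{2\log N}}\right),$$ meaning that the quotient of the left side by the expression inside $\omega(\cdot)$ tends to $+\infty$. Then with high probability the algorithm correctly determines whether $\lambda=0$ or $\lambda=\overline\lambda$: on input $T_0$ with $\lambda=0$ it reports "$\lambda=0$" with probability tending to $1$, and on input $T_0$ with $\lambda=\overline\lambda$ it reports "$\lambda=\overline\lambda$" with probability tending to $1$, as $N\to\infty$. -/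

import Mathlib

open Filter Topology MeasureTheory ProbabilityTheory Asymptotics

namespace SpikedTensor

/-! ### Tensors and the spiked tensor model -/

/-- Tensors of order `p` and dimension `N`; a real tensor is one all of whose entries are real. -/
abbrev Tensor (p N : ℕ) : Type := (Fin p → Fin N) → ℂ

/-- Symmetrization: `1 / p!` times the sum of the tensors obtained by permuting the indices. -/
noncomputable def symmetrize {p N : ℕ} (T : Tensor p N) : Tensor p N :=
  fun μ => ((Nat.factorial p : ℂ))⁻¹ * ∑ σ : Equiv.Perm (Fin p), T (μ ∘ σ)

/-- The real and the complex ensemble. -/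
inductive Ensemble
  | real
  | complex

/-- The law of one entry of the noise. Real ensemble: standard real Gaussian. Complex ensemble:
independent real and imaginary parts, each a centred Gaussian of variance `1 / 2`. -/
noncomputable def entryLaw : Ensemble → Measure ℂ
  | .real => (gaussianReal 0 1).map (fun x : ℝ => (x : ℂ))
  | .complex => ((gaussianReal 0 (1 / 2)).prod (gaussianReal 0 (1 / 2))).map
      (fun z : ℝ × ℝ => (⟨z.1, z.2⟩ : ℂ))

/-- Whether the noise tensor is symmetrized. -/
inductive Symmetrization
  | none
  | full

/-- The law of the noise tensor `G`: independent identically distributed entries, after which the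
tensor is possibly symmetrized. -/
noncomputable def noiseLaw (e : Ensemble) : Symmetrization → (p N : ℕ) → Measure (Tensor p N)
  | .none, p, N => Measure.pi (fun _ : Fin p → Fin N => entryLaw e)
  | .full, p, N => (Measure.pi (fun _ : Fin p → Fin N => entryLaw e)).map symmetrize

/-- `T₀ = lam • v^{⊗p} + G`. -/
noncomputable def spikedTensor {p N : ℕ} (lam : ℝ) (v : EuclideanSpace ℝ (Fin N))
    (G : Tensor p N) : Tensor p N :=
  fun μ => (lam : ℂ) * ∏ a : Fin p, ((v (μ a) : ℝ) : ℂ) + G μ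

/-! ### The Hamiltonian, for even `p` -/

/-- The position of the `a`-th index in the first half of the `p` indices. -/
def firstHalf {p : ℕ} (a : Fin (p / 2)) : Fin p := ⟨a.1, by have := a.2; omega⟩

/-- The position of the `a`-th index in the second half of the `p` indices. -/
def secondHalf {p : ℕ} (a : Fin (p / 2)) : Fin p := ⟨a.1 + p / 2, by have := a.2; omega⟩

open Classical in
/-- The operator `∑_μ T_μ |μ₁⟩_{i₁}⟨μ_{1+p/2}| ⊗ ⋯ ⊗ |μ_{p/2}⟩_{i_{p/2}}⟨μ_p|` on `n` qudits of
dimension `N` (the identity on the remaining qudits), as a matrix in the basis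
`|x₁⟩ ⊗ ⋯ ⊗ |xₙ⟩` of the full Hilbert space. -/
noncomputable def hamiltonianTerm {p N : ℕ} (T : Tensor p N) (n : ℕ) (i : Fin (p / 2) ↪ Fin n) :
    Matrix (Fin n → Fin N) (Fin n → Fin N) ℂ :=
  Matrix.of fun x y => ∑ μ : Fin p → Fin N, T μ *
    (if (∀ a, x (i a) = μ (firstHalf a) ∧ y (i a) = μ (secondHalf a)) ∧
        (∀ j, j ∉ Set.range i → x j = y j) then 1 else 0)

/-- The Hamiltonian `H(T)`, the sum running over tuples of `p / 2` distinct qudits. -/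
noncomputable def hamiltonian {p N : ℕ} (T : Tensor p N) (n : ℕ) :
    Matrix (Fin n → Fin N) (Fin n → Fin N) ℂ :=
  (1 / 2 : ℂ) • ∑ i : Fin (p / 2) ↪ Fin n,
    (hamiltonianTerm T n i + (hamiltonianTerm T n i).conjTranspose)

/-- The symmetric (bosonic) subspace of the full Hilbert space. -/
def symmetricSubspace (N n : ℕ) : Submodule ℂ ((Fin n → Fin N) → ℂ) where
  carrier := {ψ | ∀ (σ : Equiv.Perm (Fin n)) (x : Fin n → Fin N), ψ (x ∘ σ) = ψ x}
  add_mem' := by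
    intro φ ψ hφ hψ σ x
    simp only [Pi.add_apply, hφ σ x, hψ σ x]
  zero_mem' := by
    intro σ x
    rfl
  smul_mem' := by
    intro c ψ hψ σ x
    simp only [Pi.smul_apply, hψ σ x]

/-- The Hamiltonian may be considered on the full Hilbert space or on the symmetric subspace. -/
inductive Sector
  | full
  | symmetric

/-- The space on which the Hamiltonian is considered. -/
def Sector.space : Sector → (N n : ℕ) → Submodule ℂ ((Fin n → Fin N) → ℂ)
  | .full, _, _ => ⊤
  | .symmetric, N, n => symmetricSubspace N n

/-- The leading (largest) eigenvalue of the Hermitian matrix `M` on the invariant subspace `S`. -/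
noncomputable def leadingEigenvalue {ι : Type} [Fintype ι] (M : Matrix ι ι ℂ)
    (S : Submodule ℂ (ι → ℂ)) : ℝ :=
  sSup {t : ℝ | ∃ ψ ∈ S, ψ ≠ 0 ∧ M.mulVec ψ = (t : ℂ) • ψ}

/-! ### The thresholds and the detection step of the spectral algorithm, for even `p` -/

/-- `1` for the real ensemble and `2` for the complex ensemble. -/
def Ensemble.factor : Ensemble → ℝ
  | .real => 1
  | .complex => 2

/-- The leading-order value `(p/2)! C(n, p/2) / n^{p/2}` of `J`, doubled in the complex case. -/
noncomputable def leadingJ (e : Ensemble) (p n : ℕ) : ℝ :=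
  e.factor * ((p / 2).factorial * n.choose (p / 2) : ℝ) / (n : ℝ) ^ (p / 2)

/-- The scalar `J`. For the real ensemble `J n^{p/2} N^{p/2}` is the value, to all orders in `N`, of
`∑_{μ,ν} (∏ a†_{μᵢ}) (∏ a_{νᵢ}) (∏ a†_{νᵢ}) (∏ a_{μᵢ})` on `n` bosons with `N` modes, namely
`(p/2)! C(n, p/2)` times `(N+n-1)(N+n-2)⋯(N+n-p/2)`; in the complex case `J` is twice that. -/
noncomputable def scalarJ (e : Ensemble) (p n N : ℕ) : ℝ :=
  leadingJ e p n * ((N + n - 1).descFactorial (p / 2) : ℝ) / (N : ℝ) ^ (p / 2)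

lemma leadingJ_abs_le (e : Ensemble) (p n : ℕ) : |leadingJ e p n| ≤ 2 := by
  have hX : ((p / 2).factorial * n.choose (p / 2) : ℝ) / (n : ℝ) ^ (p / 2) ≤ 1 := by
    apply div_le_one_of_le₀ _ (by positivity)
    have h := Nat.descFactorial_le_pow n (p / 2)
    rw [Nat.descFactorial_eq_factorial_mul_choose] at h
    exact_mod_cast h
  have hX0 : 0 ≤ ((p / 2).factorial * n.choose (p / 2) : ℝ) / (n : ℝ) ^ (p / 2) := by positivity
  unfold leadingJ
  rw [mul_div_assoc, abs_mul, abs_of_nonneg hX0]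
  cases e <;> simp only [Ensemble.factor] <;> norm_num <;> linarith

/-- `J` equals its leading-order value up to `o(1)` when `n = o(N)`. -/
lemma scalarJ_sub_leadingJ_tendsto (e : Ensemble) (p : ℕ) (n : ℕ → ℕ)
    (hn : Tendsto (fun N : ℕ => (n N : ℝ) / N) atTop (𝓝 0)) :
    Tendsto (fun N : ℕ => scalarJ e p (n N) N - leadingJ e p (n N)) atTop (𝓝 0) := by
  have hr : Tendsto (fun N : ℕ => ((N + n N - 1).descFactorial (p / 2) : ℝ) / (N : ℝ) ^ (p / 2) - 1)
      atTop (𝓝 0) := by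
    have h1 : Tendsto (fun N : ℕ => ∏ i ∈ Finset.range (p / 2),
        (1 + (n N : ℝ) / N - (1 + i) * (1 / (N : ℝ)))) atTop
        (𝓝 (∏ i ∈ Finset.range (p / 2), (1 : ℝ))) := by
      apply tendsto_finsetProd
      intro i _
      have h3 := (hn.const_add 1).sub (tendsto_one_div_atTop_nhds_zero_nat.const_mul (1 + (i : ℝ)))
      simpa using h3
    rw [Finset.prod_const_one] at h1
    have h2 := h1.sub_const 1
    rw [sub_self] at h2
    refine h2.congr' ?_
    filter_upwards [eventually_ge_atTop (p + 1)] with N hN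
    have hN0 : (N : ℝ) ≠ 0 := by
      have : 0 < N := by omega
      positivity
    congr 1
    rw [Nat.descFactorial_eq_prod_range, Nat.cast_prod]
    rw [eq_div_iff (pow_ne_zero _ hN0)]
    conv_lhs => rw [← Finset.card_range (p / 2), ← Finset.prod_const, Finset.card_range]
    rw [← Finset.prod_mul_distrib]
    refine Finset.prod_congr rfl fun i hi => ?_
    have hi' := Finset.mem_range.1 hi
    have : N + n N - 1 - i = N + n N - (1 + i) := by omega
    rw [this, Nat.cast_sub (by omega)]
    push_cast
    field_simp
  have := hr.zero_mul_isBoundedUnder_le (g := fun N : ℕ => leadingJ e p (n N))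
    (isBoundedUnder_of ⟨2, fun N => leadingJ_abs_le e p (n N)⟩)
  refine this.congr fun N => ?_
  simp only [scalarJ]
  ring

/-- `E₀ = lam (p/2)! C(n, p/2) N^{p/2}`. -/
noncomputable def energyZero (p n N : ℕ) (lam : ℝ) : ℝ :=
  lam * (p / 2).factorial * n.choose (p / 2) * (N : ℝ) ^ (p / 2)

/-- `E_max = √(2 J log N) n^{p/4+1/2} N^{p/4}`. -/
noncomputable def energyMax (e : Ensemble) (p n N : ℕ) : ℝ :=
  √(2 * scalarJ e p n N * Real.log N) * (n : ℝ) ^ ((p : ℝ) / 4 + 1 / 2) * (N : ℝ) ^ ((p : ℝ) / 4)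

/-- `ξ = √J n^{p/4-1/2} N^{p/4} / √(2 log N)`. -/
noncomputable def energyScale (e : Ensemble) (p n N : ℕ) : ℝ :=
  √(scalarJ e p n N) * (n : ℝ) ^ ((p : ℝ) / 4 - 1 / 2) * (N : ℝ) ^ ((p : ℝ) / 4) /
    √(2 * Real.log N)

/-- `E_cut = (E₀ + E_max) / 2`, with `E₀` computed from `lamBar`. -/
noncomputable def energyCut (e : Ensemble) (p n N : ℕ) (lamBar : ℝ) : ℝ :=
  (energyZero p n N lamBar + energyMax e p n N) / 2

/-- On input `T`, `lamBar`, `n`, the detection step of the spectral algorithm reports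
`lam = lamBar`; if this fails, it reports `lam = 0`. -/
def ReportsSignal (e : Ensemble) (sec : Sector) {p N : ℕ} (n : ℕ) (lamBar : ℝ)
    (T : Tensor p N) : Prop :=
  energyCut e p n N lamBar < leadingEigenvalue (hamiltonian T n) (sec.space N n)

end SpikedTensor

/-!
The noise part of the Hamiltonian is a Gaussian series `X = ∑ₖ gₖ Aₖ` of Hermitian matrices on a
space of dimension `d = Nⁿ`, so the false alarm probability is a matrix concentration statement
with the sharp constant in the exponent: if `∑ₖ E gₖ² Aₖ² ≤ W`, then
`P (λ₁ ≥ T) ≤ 2 d exp (β² W / 2 - β T)` for every `β ≥ 0`. It is proved by moments. Gaussian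
integration by parts writes `E tr X²ᵐ⁺²` as a sum of `2m + 1` families of traces
`tr (Aₖ Xᵃ Aₖ Xᵇ)`, `a + b = 2m`, and each of these is at most `tr (Aₖ² X²ᵐ)`
(`re_trace_mul_pow_mul_pow_le`). Hence the even moments obey the recursion of a scalar Gaussian of
variance `W` (`integral_re_trace_pow_succ_le`), they sum to `E tr cosh (β X) ≤ d exp (β² W / 2)`
(`lintegral_traceCosh_matrixSeries_le`), and Markov's inequality concludes. This bound on the full
space also covers the symmetric subspace.

For the matrix variance, write the coefficient of an entry of the tensor as `(B + Bᴴ) / 2` with `B`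
a sum of hopping operators over tuples of qudits; convexity of the square of the norm reduces matters
to `∑ ‖B ψ‖²`, the sum running over all entries. Expanding over pairs of tuples, with
`D = n (n - 1) ⋯ (n - p/2 + 1)` tuples in all, each equal pair contributes `N ^ (p / 2)` and each
unequal one at most `N ^ (p / 2 - 1)`, so that `W ≤ V (1 + n ^ (p / 2) / N)` for
`V = J n ^ (p / 2) N ^ (p / 2)` (`sum_norm_hopSum_mulVec_le`, `varianceBound_le`). Symmetrizing the
noise is averaging, which does not increase the variance, and the complex ensemble is handled
through its real and imaginary parts.

Since `E_max² = 2 V n log N` and the energy scale is `ξ = V / E_max`, the choice `β = E_max / W`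
turns the false alarm bound into `exp (O (ε n log N) - q / 4)`, where `ε = n ^ (p / 2) / N` and
`q = (E₀ - E_max) / ξ → ∞`. The exponent `θ = 1 / (2 (p / 2 + 1))` makes `ε n log N → 0`.

When the signal is present, the product state `v^{⊗n}`, which lies in the symmetric subspace, has
energy `E₀` plus `D N ^ (- p / 2)` times the overlap of the noise with `v^{⊗p}`, a Gaussian of
variance at most `N ^ p`. The fluctuation is thus of order `D`, and `D ≤ ξ` for large `N`
(`descFactorial_le_energyScale`), so the variational principle puts the largest eigenvalue above the
threshold.
-/

namespace SpikedTensor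

/-! ### Gaussian integration by parts -/

/-- Stein's identity for a centred Gaussian on the line. -/
lemma integral_id_mul_gaussianReal {s : NNReal} (hs : s ≠ 0) {f f' : ℝ → ℝ}
    (hd : ∀ x, HasDerivAt f (f' x) x) (hf : Integrable f (gaussianReal 0 s))
    (hxf : Integrable (fun x => x * f x) (gaussianReal 0 s))
    (hf' : Integrable f' (gaussianReal 0 s)) :
    ∫ x, x * f x ∂(gaussianReal 0 s) = s * ∫ x, f' x ∂(gaussianReal 0 s) := by
  have hs' : (s : ℝ) ≠ 0 := by exact_mod_cast hs
  have key : ∀ g : ℝ → ℝ, Integrable g (gaussianReal 0 s) →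
      Integrable (fun x => gaussianPDFReal 0 s x * g x) := by
    intro g hg
    rw [gaussianReal_of_var_ne_zero 0 hs, integrable_withDensity_iff_integrable_smul'
      (measurable_gaussianPDF 0 s) (.of_forall fun _ => gaussianPDF_lt_top)] at hg
    refine hg.congr (.of_forall fun x => ?_)
    simp only [toReal_gaussianPDF, smul_eq_mul]
  have hpdf : ∀ x, HasDerivAt (gaussianPDFReal 0 s) (gaussianPDFReal 0 s x * (-(x / s))) x := by
    intro x
    have h1 : HasDerivAt (fun x : ℝ => -(x - 0) ^ 2 / (2 * (s : ℝ))) (-(x / s)) x := by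
      have := ((((hasDerivAt_id x).sub_const 0).pow 2).neg).div_const (2 * (s : ℝ))
      refine this.congr_deriv ?_
      simp
      field_simp
    have := h1.exp.const_mul ((√(2 * Real.pi * s))⁻¹)
    refine this.congr_deriv ?_
    simp only [gaussianPDFReal]
    ring
  have hF : ∀ x, HasDerivAt (fun x => gaussianPDFReal 0 s x * f x)
      (gaussianPDFReal 0 s x * f' x - (gaussianPDFReal 0 s x * (x * f x)) / s) x := by
    intro x
    refine ((hpdf x).mul (hd x)).congr_deriv ?_
    ring
  have h0 := integral_eq_zero_of_hasDerivAt_of_integrable hF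
    ((key _ hf').sub ((key _ hxf).div_const _)) (key _ hf)
  rw [integral_sub (key _ hf') ((key _ hxf).div_const _), integral_div, sub_eq_zero,
    eq_div_iff hs'] at h0
  rw [integral_gaussianReal_eq_integral_smul hs, integral_gaussianReal_eq_integral_smul hs]
  simp only [smul_eq_mul]
  rw [← h0, mul_comm]

section Pi

variable {κ : Type*} [Fintype κ] [DecidableEq κ]

/-- Resampling one coordinate of a product of probability measures does not change the law. -/
lemma measurePreserving_update (ν : κ → Measure ℝ) [∀ k, IsProbabilityMeasure (ν k)] (k : κ) :
    MeasurePreserving (fun z : (κ → ℝ) × ℝ => Function.update z.1 k z.2)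
      ((Measure.pi ν).prod (ν k)) (Measure.pi ν) := by
  refine ⟨by fun_prop, ?_⟩
  symm
  refine Measure.pi_eq fun S hS => ?_
  have hm : Measurable (fun z : (κ → ℝ) × ℝ => Function.update z.1 k z.2) := by fun_prop
  rw [Measure.map_apply hm (MeasurableSet.univ_pi hS)]
  have : (fun z : (κ → ℝ) × ℝ => Function.update z.1 k z.2) ⁻¹' (Set.univ.pi S) =
      (Set.univ.pi (Function.update S k Set.univ)) ×ˢ (S k) := by
    ext ⟨g, t⟩
    simp only [Set.mem_preimage, Set.mem_pi, Set.mem_univ, true_implies, Set.mem_prod]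
    constructor
    · intro h
      refine ⟨fun j => ?_, by simpa using h k⟩
      by_cases hj : j = k
      · subst hj; simp
      · simpa [hj] using h j
    · rintro ⟨h1, h2⟩ j
      by_cases hj : j = k
      · subst hj; simpa using h2
      · simpa [hj] using h1 j
  rw [this, Measure.prod_prod, Measure.pi_pi, ← Finset.mul_prod_erase _ _ (Finset.mem_univ k),
    ← Finset.mul_prod_erase _ (fun i => ν i (S i)) (Finset.mem_univ k)]
  simp only [Function.update_self, measure_univ, one_mul]
  rw [mul_comm]
  congr 1
  refine Finset.prod_congr rfl fun j hj => ?_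
  rw [Function.update_of_ne (Finset.ne_of_mem_erase hj)]

/-- Gaussian integration by parts in one coordinate of a vector of independent Gaussians. -/
lemma integral_coord_mul_pi_gaussianReal {s : NNReal} (hs : s ≠ 0) (k : κ) {F F' : (κ → ℝ) → ℝ}
    (hd : ∀ g t, HasDerivAt (fun t => F (Function.update g k t)) (F' (Function.update g k t)) t)
    (hF : Integrable F (Measure.pi fun _ : κ => gaussianReal 0 s))
    (hgF : Integrable (fun g => g k * F g) (Measure.pi fun _ : κ => gaussianReal 0 s))
    (hF' : Integrable F' (Measure.pi fun _ : κ => gaussianReal 0 s)) :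
    ∫ g, g k * F g ∂(Measure.pi fun _ : κ => gaussianReal 0 s) =
      s * ∫ g, F' g ∂(Measure.pi fun _ : κ => gaussianReal 0 s) := by
  have mp := measurePreserving_update (fun _ : κ => gaussianReal 0 s) k
  have tr : ∀ h : (κ → ℝ) → ℝ, Integrable h (Measure.pi fun _ : κ => gaussianReal 0 s) →
      Integrable (fun z : (κ → ℝ) × ℝ => h (Function.update z.1 k z.2))
        ((Measure.pi fun _ : κ => gaussianReal 0 s).prod (gaussianReal 0 s)) :=
    fun h hh => mp.integrable_comp_of_integrable hh
  have ti : ∀ h : (κ → ℝ) → ℝ, Integrable h (Measure.pi fun _ : κ => gaussianReal 0 s) →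
      ∫ g, h g ∂(Measure.pi fun _ : κ => gaussianReal 0 s) =
        ∫ g, ∫ t, h (Function.update g k t) ∂(gaussianReal 0 s)
          ∂(Measure.pi fun _ : κ => gaussianReal 0 s) := by
    intro h hh
    rw [← integral_prod _ (tr h hh)]
    conv_lhs => rw [← mp.map_eq]
    rw [integral_map mp.measurable.aemeasurable (by rw [mp.map_eq]; exact hh.1)]
  rw [ti _ hgF, ti _ hF', ← integral_const_mul]
  refine integral_congr_ae ?_
  filter_upwards [(tr _ hF).prod_right_ae, (tr _ hgF).prod_right_ae, (tr _ hF').prod_right_ae]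
    with g h1 h2 h3
  simp only [Function.update_self] at h2 ⊢
  exact integral_id_mul_gaussianReal hs (hd g) h1 h2 h3

end Pi

lemma memLp_coord_pi_gaussianReal {κ : Type*} [Fintype κ] (s : NNReal) (k : κ)
    {q : ENNReal} (hq : q ≠ ⊤) :
    MemLp (fun g : κ → ℝ => g k) q (Measure.pi fun _ : κ => gaussianReal 0 s) :=
  (memLp_id_gaussianReal' q hq).comp_measurePreserving
    (measurePreserving_eval (fun _ : κ => gaussianReal 0 s) k)

/-- Products of functions with finite moments of all orders have finite moments of all orders. -/
lemma memLp_mul_of_forall_memLp {Ω : Type*} [MeasurableSpace Ω] {μ : Measure Ω} {f g : Ω → ℂ}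
    (hf : ∀ q : ENNReal, q ≠ ⊤ → MemLp f q μ) (hg : ∀ q : ENNReal, q ≠ ⊤ → MemLp g q μ)
    (q : ENNReal) (hq : q ≠ ⊤) : MemLp (fun x => f x * g x) q μ := by
  have : ENNReal.HolderTriple (2 * q) (2 * q) q := by
    constructor
    rw [ENNReal.mul_inv (by simp) (by simp), ← add_mul, ENNReal.inv_two_add_inv_two, one_mul]
  exact (hg (2 * q) (ENNReal.mul_ne_top (by simp) hq)).mul
    (hf (2 * q) (ENNReal.mul_ne_top (by simp) hq))

/-! ### Moments of matrix Gaussian series -/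

lemma pow_mul_pow_add_pow_mul_pow_le {x y : ℝ} {a b : ℕ} (hab : Even (a + b)) :
    x ^ a * y ^ b + y ^ a * x ^ b ≤ x ^ (a + b) + y ^ (a + b) := by
  have h1 : 0 ≤ (|x| ^ a - |y| ^ a) * (|x| ^ b - |y| ^ b) := by
    rcases le_total |x| |y| with h | h
    · exact mul_nonneg_of_nonpos_of_nonpos
        (sub_nonpos.2 (pow_le_pow_left₀ (abs_nonneg _) h _))
        (sub_nonpos.2 (pow_le_pow_left₀ (abs_nonneg _) h _))
    · exact mul_nonneg
        (sub_nonneg.2 (pow_le_pow_left₀ (abs_nonneg _) h _))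
        (sub_nonneg.2 (pow_le_pow_left₀ (abs_nonneg _) h _))
  have h2 : ∀ u w : ℝ, u ^ a * w ^ b ≤ |u| ^ a * |w| ^ b := fun u w => by
    rw [← abs_pow, ← abs_pow, ← abs_mul]; exact le_abs_self _
  rw [← hab.pow_abs x, ← hab.pow_abs y, pow_add, pow_add]
  linarith [h2 x y, h2 y x]

section Matrix

variable {ι : Type*} [Fintype ι] [DecidableEq ι]

/-- In an eigenbasis of `H` the two sides are `∑ |Aₓᵧ|² hᵧᵃ hₓᵇ` and `∑ |Aₓᵧ|² hₓᵃ⁺ᵇ`. -/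
lemma re_trace_mul_pow_mul_pow_le {A H : Matrix ι ι ℂ} (hA : A.IsHermitian) (hH : H.IsHermitian)
    {a b : ℕ} (hab : Even (a + b)) :
    (A * H ^ a * A * H ^ b).trace.re ≤ (A * A * H ^ (a + b)).trace.re := by
  set U : Matrix ι ι ℂ := (hH.eigenvectorUnitary : Matrix ι ι ℂ) with hU
  set D : Matrix ι ι ℂ := Matrix.diagonal (fun x => (hH.eigenvalues x : ℂ)) with hD
  have hUU : star U * U = 1 := Unitary.coe_star_mul_self hH.eigenvectorUnitary
  have hUU' : U * star U = 1 := Unitary.coe_mul_star_self hH.eigenvectorUnitary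
  have hHU : H = U * D * star U := by
    conv_lhs => rw [hH.spectral_theorem, Unitary.conjStarAlgAut_apply]
    rfl
  have hpow : ∀ m : ℕ, H ^ m = U * D ^ m * star U := by
    intro m
    induction m with
    | zero => simp [hUU']
    | succ m ih =>
      rw [pow_succ, ih]
      nth_rewrite 1 [hHU]
      calc U * D ^ m * star U * (U * D * star U)
          = U * D ^ m * (star U * U) * D * star U := by simp only [mul_assoc]
        _ = _ := by rw [hUU, mul_one, pow_succ]; simp only [mul_assoc]
  set B : Matrix ι ι ℂ := star U * A * U with hB
  have hBh : B.IsHermitian := by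
    have := Matrix.isHermitian_conjTranspose_mul_mul U hA
    simpa [hB, Matrix.star_eq_conjTranspose] using this
  have e1 : (A * H ^ a * A * H ^ b).trace = (B * D ^ a * B * D ^ b).trace := by
    have : A * H ^ a * A * H ^ b = (A * U * D ^ a * B * D ^ b) * star U := by
      rw [hpow, hpow, hB]; simp only [mul_assoc]
    rw [this, Matrix.trace_mul_comm, hB]
    simp only [mul_assoc]
  have e2 : (A * A * H ^ (a + b)).trace = (B * B * D ^ (a + b)).trace := by
    have : A * A * H ^ (a + b) = (A * U * B * D ^ (a + b)) * star U := by
      calc A * A * H ^ (a + b) = A * (U * star U) * A * H ^ (a + b) := by rw [hUU', mul_one]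
        _ = _ := by rw [hpow, hB]; simp only [mul_assoc]
    rw [this, Matrix.trace_mul_comm, hB]
    simp only [mul_assoc]
  have hBx : ∀ x y, B x y * B y x = ((‖B x y‖ ^ 2 : ℝ) : ℂ) := by
    intro x y
    rw [← hBh.apply y x]
    push_cast
    exact Complex.mul_conj' _
  have hDm : ∀ m, D ^ m = Matrix.diagonal (fun x => ((hH.eigenvalues x ^ m : ℝ) : ℂ)) := by
    intro m
    rw [hD, Matrix.diagonal_pow]
    congr 1
    ext x
    simp
  have e3 : (B * D ^ a * B * D ^ b).trace.re =
      ∑ x, ∑ y, ‖B x y‖ ^ 2 * (hH.eigenvalues y ^ a * hH.eigenvalues x ^ b) := by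
    rw [hDm, hDm]
    simp only [Matrix.trace, Matrix.diag, Complex.re_sum]
    refine Finset.sum_congr rfl fun x _ => ?_
    rw [Matrix.mul_diagonal, Matrix.mul_apply, Finset.sum_mul, Complex.re_sum]
    refine Finset.sum_congr rfl fun y _ => ?_
    rw [Matrix.mul_diagonal]
    rw [show B x y * ((hH.eigenvalues y ^ a : ℝ) : ℂ) * B y x * ((hH.eigenvalues x ^ b : ℝ) : ℂ)
      = (B x y * B y x) * ((hH.eigenvalues y ^ a * hH.eigenvalues x ^ b : ℝ) : ℂ) by
        push_cast; ring, hBx, ← Complex.ofReal_mul, Complex.ofReal_re]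
  have e4 : (B * B * D ^ (a + b)).trace.re =
      ∑ x, ∑ y, ‖B x y‖ ^ 2 * hH.eigenvalues x ^ (a + b) := by
    rw [hDm]
    simp only [Matrix.trace, Matrix.diag, Matrix.mul_diagonal]
    simp only [Matrix.mul_apply, Complex.re_sum, Finset.sum_mul]
    refine Finset.sum_congr rfl fun x _ => Finset.sum_congr rfl fun y _ => ?_
    rw [hBx, ← Complex.ofReal_mul, Complex.ofReal_re]
  have hsymm : ∀ x y, ‖B y x‖ = ‖B x y‖ := fun x y => by
    rw [← hBh.apply y x, norm_star]
  rw [e1, e2, e3, e4]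
  have f1 : ∑ x, ∑ y, ‖B x y‖ ^ 2 * (hH.eigenvalues y ^ a * hH.eigenvalues x ^ b) =
      ∑ x, ∑ y, ‖B x y‖ ^ 2 * (hH.eigenvalues x ^ a * hH.eigenvalues y ^ b) := by
    rw [Finset.sum_comm]
    simp only [hsymm]
  have f2 : ∑ x, ∑ y, ‖B x y‖ ^ 2 * hH.eigenvalues x ^ (a + b) =
      ∑ x, ∑ y, ‖B x y‖ ^ 2 * hH.eigenvalues y ^ (a + b) := by
    rw [Finset.sum_comm]
    simp only [hsymm]
  have f3 : ∑ x, ∑ y, ‖B x y‖ ^ 2 * (hH.eigenvalues y ^ a * hH.eigenvalues x ^ b) +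
      ∑ x, ∑ y, ‖B x y‖ ^ 2 * (hH.eigenvalues x ^ a * hH.eigenvalues y ^ b) ≤
      ∑ x, ∑ y, ‖B x y‖ ^ 2 * hH.eigenvalues x ^ (a + b) +
      ∑ x, ∑ y, ‖B x y‖ ^ 2 * hH.eigenvalues y ^ (a + b) := by
    simp only [← Finset.sum_add_distrib]
    refine Finset.sum_le_sum fun x _ => Finset.sum_le_sum fun y _ => ?_
    rw [← mul_add, ← mul_add]
    refine mul_le_mul_of_nonneg_left ?_ (by positivity)
    have := pow_mul_pow_add_pow_mul_pow_le (x := hH.eigenvalues x) (y := hH.eigenvalues y) hab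
    linarith
  linarith

open scoped ComplexOrder in
/-- An even power of an eigenvalue is at most the trace of that power of a Hermitian matrix. -/
lemma pow_le_re_trace_pow {H : Matrix ι ι ℂ} (hH : H.IsHermitian) {t : ℝ} {ψ : ι → ℂ}
    (hψ : ψ ≠ 0) (ht : H.mulVec ψ = (t : ℂ) • ψ) (q : ℕ) :
    t ^ (2 * q) ≤ (H ^ (2 * q)).trace.re := by
  have hp : (H ^ (2 * q)).mulVec ψ = ((t ^ (2 * q) : ℝ) : ℂ) • ψ := by
    generalize 2 * q = m
    induction m with
    | zero => simp
    | succ m ih =>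
      rw [pow_succ, ← Matrix.mulVec_mulVec, ht, Matrix.mulVec_smul, ih, smul_smul]
      push_cast
      ring_nf
  have hP : (H ^ (2 * q)).PosSemidef := by
    have := Matrix.posSemidef_conjTranspose_mul_self (H ^ q)
    rwa [Matrix.conjTranspose_pow, hH.eq, ← pow_add, ← two_mul] at this
  set P := H ^ (2 * q)
  have hev : ∃ x, hP.1.eigenvalues x = t ^ (2 * q) := by
    have h1 : Module.End.HasEigenvalue (Matrix.toLin' P) ((t ^ (2 * q) : ℝ) : ℂ) :=
      Module.End.hasEigenvalue_of_hasEigenvector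
        (x := ψ) ⟨Module.End.mem_eigenspace_iff.2 (by simpa using hp), hψ⟩
    have h2 := Module.End.hasEigenvalue_iff_mem_spectrum.1 h1
    rw [Matrix.spectrum_toLin', hP.1.spectrum_eq_image_range] at h2
    obtain ⟨_, ⟨x, rfl⟩, hx⟩ := h2
    exact ⟨x, Complex.ofReal_injective (by simpa using hx)⟩
  obtain ⟨x, hx⟩ := hev
  rw [hP.1.trace_eq_sum_eigenvalues, ← hx]
  simp only [← Complex.ofReal_sum, Complex.coe_algebraMap,
    Complex.ofReal_re]
  exact Finset.single_le_sum (f := hP.1.eigenvalues) (fun y _ => hP.eigenvalues_nonneg y)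
    (Finset.mem_univ x)

end Matrix

/-- A random matrix has finite moments if all its entries have finite moments of all orders. -/
def HasMoments {Ω ι : Type*} [MeasurableSpace Ω] (M : Ω → Matrix ι ι ℂ) (μ : Measure Ω) : Prop :=
  ∀ x y, ∀ q : ENNReal, q ≠ ⊤ → MemLp (fun ω => M ω x y) q μ

section HasMoments

variable {Ω ι : Type*} [MeasurableSpace Ω] {μ : Measure Ω}

lemma hasMoments_const [IsFiniteMeasure μ] (L : Matrix ι ι ℂ) : HasMoments (fun _ : Ω => L) μ :=
  fun _ _ _ _ => memLp_const _

lemma HasMoments.smul {M : Ω → Matrix ι ι ℂ} {f : Ω → ℂ}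
    (hM : HasMoments M μ) (hf : ∀ q : ENNReal, q ≠ ⊤ → MemLp f q μ) :
    HasMoments (fun ω => f ω • M ω) μ :=
  fun x y q hq => memLp_mul_of_forall_memLp hf (hM x y) q hq

variable [Fintype ι]

lemma HasMoments.mul {M L : Ω → Matrix ι ι ℂ} (hM : HasMoments M μ) (hL : HasMoments L μ) :
    HasMoments (fun ω => M ω * L ω) μ := by
  intro x y q hq
  simp only [Matrix.mul_apply]
  exact memLp_finsetSum _ fun z _ => memLp_mul_of_forall_memLp (hM x z) (hL z y) q hq

lemma HasMoments.pow [DecidableEq ι] [IsFiniteMeasure μ] {M : Ω → Matrix ι ι ℂ}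
    (hM : HasMoments M μ) (m : ℕ) : HasMoments (fun ω => M ω ^ m) μ := by
  induction m with
  | zero => simpa using hasMoments_const 1
  | succ m ih => simpa only [pow_succ] using ih.mul hM

lemma HasMoments.integrable_re_trace {M : Ω → Matrix ι ι ℂ} (hM : HasMoments M μ) :
    Integrable (fun ω => (M ω).trace.re) μ := by
  have : Integrable (fun ω => (M ω).trace) μ := by
    simp only [Matrix.trace, Matrix.diag]
    exact integrable_finsetSum _ fun x _ => memLp_one_iff_integrable.1 (hM x x 1 (by simp))
  exact this.re

end HasMoments

/-- The matrix Gaussian series `∑ₖ gₖ Aₖ`. -/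
noncomputable def matrixSeries {κ ι : Type*} [Fintype κ] (A : κ → Matrix ι ι ℂ) (g : κ → ℝ) :
    Matrix ι ι ℂ :=
  ∑ k, (g k : ℂ) • A k

section Series

variable {κ ι : Type*} [Fintype κ]

lemma isHermitian_matrixSeries {A : κ → Matrix ι ι ℂ} (hA : ∀ k, (A k).IsHermitian) (g : κ → ℝ) :
    (matrixSeries A g).IsHermitian := by
  rw [Matrix.IsHermitian, matrixSeries, Matrix.conjTranspose_sum]
  refine Finset.sum_congr rfl fun k _ => ?_
  rw [Matrix.conjTranspose_smul, (hA k).eq]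
  simp

lemma hasMoments_matrixSeries (A : κ → Matrix ι ι ℂ) (s : NNReal) :
    HasMoments (matrixSeries A) (Measure.pi fun _ : κ => gaussianReal 0 s) := by
  intro x y q hq
  simp only [matrixSeries, Matrix.sum_apply, Matrix.smul_apply, smul_eq_mul]
  refine memLp_finsetSum _ fun k _ => ?_
  exact (memLp_coord_pi_gaussianReal s k hq).ofReal.mul_const _

lemma matrixSeries_update [DecidableEq κ] (A : κ → Matrix ι ι ℂ) (g : κ → ℝ) (k : κ) (t : ℝ) :
    matrixSeries A (Function.update g k t) =
      matrixSeries A (Function.update g k 0) + t • A k := by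
  simp only [matrixSeries]
  rw [← Finset.add_sum_erase _ _ (Finset.mem_univ k),
    ← Finset.add_sum_erase _ (fun j => ((Function.update g k 0 j : ℝ) : ℂ) • A j)
      (Finset.mem_univ k)]
  simp only [Function.update_self, Complex.ofReal_zero, zero_smul, zero_add]
  rw [add_comm]
  congr 1
  refine Finset.sum_congr rfl fun j hj => ?_
  simp only [Function.update_of_ne (Finset.ne_of_mem_erase hj)]

variable [Fintype ι]

lemma trace_conjTranspose_mul_self_re (M : Matrix ι ι ℂ) :
    (M.conjTranspose * M).trace.re = ∑ y, ∑ x, ‖M x y‖ ^ 2 := by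
  simp only [Matrix.trace, Matrix.diag, Matrix.mul_apply, Matrix.conjTranspose_apply,
    Complex.re_sum]
  refine Finset.sum_congr rfl fun y _ => Finset.sum_congr rfl fun x _ => ?_
  rw [Complex.star_def, Complex.conj_mul']
  norm_cast

variable [DecidableEq ι]

attribute [local instance] Matrix.linftyOpNormedRing Matrix.linftyOpNormedAlgebra

lemma hasDerivAt_re_trace_mul_matrixSeries_pow [DecidableEq κ] (A : κ → Matrix ι ι ℂ) (g : κ → ℝ)
    (k : κ) (m : ℕ) (t : ℝ) :
    HasDerivAt (fun t => (A k * matrixSeries A (Function.update g k t) ^ m).trace.re)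
      (∑ i ∈ Finset.range m, (A k * matrixSeries A (Function.update g k t) ^ (m.pred - i) * A k *
        matrixSeries A (Function.update g k t) ^ i).trace.re) t := by
  have h1 : HasDerivAt (fun t : ℝ => matrixSeries A (Function.update g k t)) (A k) t := by
    rw [funext (matrixSeries_update A g k)]
    exact (((hasDerivAt_id t).smul_const (A k)).const_add
      (matrixSeries A (Function.update g k 0))).congr_deriv (one_smul _ _)
  have h2 := (h1.fun_pow' m).const_mul (A k)
  let L : Matrix ι ι ℂ →L[ℝ] ℝ := LinearMap.toContinuousLinearMap
    (Complex.reLm.comp (Matrix.traceLinearMap ι ℝ ℂ))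
  have h3 := L.hasFDerivAt.comp_hasDerivAt t h2
  refine h3.congr_deriv ?_
  change (A k * ∑ i ∈ Finset.range m, matrixSeries A (Function.update g k t) ^ (m.pred - i) * A k *
    matrixSeries A (Function.update g k t) ^ i).trace.re = _
  rw [Finset.mul_sum, Matrix.trace_sum, Complex.re_sum]
  simp only [← mul_assoc]

/-- If `s ∑ₖ Aₖ² ≤ W` as quadratic forms, then `s ∑ₖ tr (Aₖ² H²ᵐ) ≤ W tr H²ᵐ`. -/
lemma sum_re_trace_mul_pow_le {A : κ → Matrix ι ι ℂ} (hA : ∀ k, (A k).IsHermitian) {s W : ℝ}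
    (hW : ∀ ψ : ι → ℂ, s * ∑ k, ∑ x, ‖(A k).mulVec ψ x‖ ^ 2 ≤ W * ∑ x, ‖ψ x‖ ^ 2)
    {H : Matrix ι ι ℂ} (hH : H.IsHermitian) (m : ℕ) :
    s * ∑ k, (A k * A k * H ^ (2 * m)).trace.re ≤ W * (H ^ (2 * m)).trace.re := by
  have hQ : (H ^ m).conjTranspose = H ^ m := by rw [Matrix.conjTranspose_pow, hH.eq]
  have e1 : (H ^ (2 * m)).trace.re = ∑ y, ∑ x, ‖(H ^ m) x y‖ ^ 2 := by
    rw [← trace_conjTranspose_mul_self_re, hQ, ← pow_add, two_mul]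
  have e2 : ∀ k, (A k * A k * H ^ (2 * m)).trace.re =
      ∑ y, ∑ x, ‖(A k).mulVec (fun z => (H ^ m) z y) x‖ ^ 2 := by
    intro k
    have := trace_conjTranspose_mul_self_re (A k * H ^ m)
    rw [Matrix.conjTranspose_mul, hQ, (hA k).eq, ← mul_assoc] at this
    rw [two_mul, pow_add, ← mul_assoc, Matrix.trace_mul_comm]
    simp only [← mul_assoc] at this ⊢
    exact this
  simp only [e2]
  rw [e1, Finset.sum_comm, Finset.mul_sum, Finset.mul_sum]
  exact Finset.sum_le_sum fun y _ => hW _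

/-- The moment recursion, the matrix form of `E g²ᵐ⁺² = (2m + 1) E g²ᵐ`: integration by parts
produces `2m + 1` traces `tr (Aₖ Xᵃ Aₖ Xᵇ)`, each at most `tr (Aₖ² X²ᵐ)`. -/
lemma integral_re_trace_pow_succ_le {A : κ → Matrix ι ι ℂ} (hA : ∀ k, (A k).IsHermitian)
    {s : NNReal} (hs : s ≠ 0) {W : ℝ}
    (hW : ∀ ψ : ι → ℂ, s * ∑ k, ∑ x, ‖(A k).mulVec ψ x‖ ^ 2 ≤ W * ∑ x, ‖ψ x‖ ^ 2) (m : ℕ) :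
    ∫ g, (matrixSeries A g ^ (2 * (m + 1))).trace.re ∂(Measure.pi fun _ : κ => gaussianReal 0 s) ≤
      (2 * m + 1) * W *
        ∫ g, (matrixSeries A g ^ (2 * m)).trace.re ∂(Measure.pi fun _ : κ => gaussianReal 0 s) := by
  classical
  set γ := Measure.pi fun _ : κ => gaussianReal 0 s with hγ
  have hX := hasMoments_matrixSeries A s
  rw [← hγ] at hX
  have hpow := fun j => hX.pow j
  have hg : ∀ k, ∀ q : ENNReal, q ≠ ⊤ → MemLp (fun g : κ → ℝ => ((g k : ℝ) : ℂ)) q γ :=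
    fun k q hq => (memLp_coord_pi_gaussianReal s k hq).ofReal
  have hAX : ∀ k j, HasMoments (fun g => A k * matrixSeries A g ^ j) γ :=
    fun k j => (hasMoments_const (A k)).mul (hpow j)
  have hD : ∀ k i, Integrable (fun g => (A k * matrixSeries A g ^ (2 * m - i) * A k *
      matrixSeries A g ^ i).trace.re) γ := fun k i =>
    (((hAX k _).mul (hasMoments_const (A k))).mul (hpow i)).integrable_re_trace
  have hAA : ∀ k, Integrable (fun g => (A k * A k * matrixSeries A g ^ (2 * m)).trace.re) γ :=
    fun k => ((hasMoments_const (A k * A k)).mul (hpow _)).integrable_re_trace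
  have ibp : ∀ k, ∫ g, g k * (A k * matrixSeries A g ^ (2 * m + 1)).trace.re ∂γ =
      s * ∫ g, ∑ i ∈ Finset.range (2 * m + 1), (A k * matrixSeries A g ^ (2 * m - i) * A k *
        matrixSeries A g ^ i).trace.re ∂γ := by
    intro k
    refine integral_coord_mul_pi_gaussianReal hs k
      (fun g t => hasDerivAt_re_trace_mul_matrixSeries_pow A g k (2 * m + 1) t)
      (hAX k _).integrable_re_trace ?_ (integrable_finsetSum _ fun i _ => hD k i)
    refine (((hAX k (2 * m + 1)).smul (hg k)).integrable_re_trace).congr (.of_forall fun g => ?_)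
    simp only [Matrix.trace_smul, smul_eq_mul, Complex.re_ofReal_mul]
  have hle : ∀ k, ∫ g, ∑ i ∈ Finset.range (2 * m + 1), (A k * matrixSeries A g ^ (2 * m - i) * A k *
        matrixSeries A g ^ i).trace.re ∂γ ≤
      (2 * m + 1) * ∫ g, (A k * A k * matrixSeries A g ^ (2 * m)).trace.re ∂γ := by
    intro k
    rw [← integral_const_mul]
    refine integral_mono (integrable_finsetSum _ fun i _ => hD k i) ((hAA k).const_mul _)
      fun g => ?_
    calc ∑ i ∈ Finset.range (2 * m + 1), (A k * matrixSeries A g ^ (2 * m - i) * A k *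
        matrixSeries A g ^ i).trace.re
        ≤ ∑ i ∈ Finset.range (2 * m + 1),
          (A k * A k * matrixSeries A g ^ (2 * m)).trace.re := by
          refine Finset.sum_le_sum fun i hi => ?_
          have hi' : 2 * m - i + i = 2 * m := by have := Finset.mem_range.1 hi; omega
          have := re_trace_mul_pow_mul_pow_le (hA k) (isHermitian_matrixSeries hA g)
            (a := 2 * m - i) (b := i) (by rw [hi']; exact even_two_mul m)
          rwa [hi'] at this
      _ = _ := by simp
  have hsplit : ∀ g, (matrixSeries A g ^ (2 * (m + 1))).trace.re =
      ∑ k, g k * (A k * matrixSeries A g ^ (2 * m + 1)).trace.re := by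
    intro g
    rw [show 2 * (m + 1) = (2 * m + 1) + 1 by ring, pow_succ']
    nth_rewrite 1 [matrixSeries]
    rw [Finset.sum_mul, Matrix.trace_sum, Complex.re_sum]
    refine Finset.sum_congr rfl fun k _ => ?_
    rw [Matrix.smul_mul, Matrix.trace_smul, smul_eq_mul, Complex.re_ofReal_mul]
  simp only [hsplit]
  rw [integral_finsetSum]
  swap
  · intro k _
    refine (((hAX k (2 * m + 1)).smul (hg k)).integrable_re_trace).congr (.of_forall fun g => ?_)
    simp only [Matrix.trace_smul, smul_eq_mul, Complex.re_ofReal_mul]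
  calc ∑ k, ∫ g, g k * (A k * matrixSeries A g ^ (2 * m + 1)).trace.re ∂γ
      ≤ ∑ k, s * ((2 * m + 1) * ∫ g, (A k * A k * matrixSeries A g ^ (2 * m)).trace.re ∂γ) := by
        refine Finset.sum_le_sum fun k _ => ?_
        rw [ibp k]
        exact mul_le_mul_of_nonneg_left (hle k) s.2
    _ = (2 * m + 1) * ∫ g, s * ∑ k, (A k * A k * matrixSeries A g ^ (2 * m)).trace.re ∂γ := by
        rw [integral_const_mul, integral_finsetSum _ fun k _ => hAA k, Finset.mul_sum,
          Finset.mul_sum]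
        exact Finset.sum_congr rfl fun k _ => by ring
    _ ≤ (2 * m + 1) * ∫ g, W * (matrixSeries A g ^ (2 * m)).trace.re ∂γ := by
        refine mul_le_mul_of_nonneg_left ?_ (by positivity)
        exact integral_mono ((integrable_finsetSum _ fun k _ => hAA k).const_mul _)
          ((hpow _).integrable_re_trace.const_mul _)
          fun g => sum_re_trace_mul_pow_le hA hW (isHermitian_matrixSeries hA g) m
    _ = _ := by rw [integral_const_mul]; ring

/-- Gaussian moment growth: `E tr X²ᵐ ≤ d (2m - 1)‼ Wᵐ`, with `(2m - 1)‼ = (2m)! / (2ᵐ m!)`. -/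
lemma integral_re_trace_pow_le {A : κ → Matrix ι ι ℂ} (hA : ∀ k, (A k).IsHermitian)
    {s : NNReal} (hs : s ≠ 0) {W : ℝ} (hW0 : 0 ≤ W)
    (hW : ∀ ψ : ι → ℂ, s * ∑ k, ∑ x, ‖(A k).mulVec ψ x‖ ^ 2 ≤ W * ∑ x, ‖ψ x‖ ^ 2) (m : ℕ) :
    (∫ g, (matrixSeries A g ^ (2 * m)).trace.re ∂(Measure.pi fun _ : κ => gaussianReal 0 s)) /
      (2 * m).factorial ≤ Fintype.card ι * ((W / 2) ^ m / m.factorial) := by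
  induction m with
  | zero => simp [Matrix.trace_one]
  | succ m ih =>
    have h := integral_re_trace_pow_succ_le hA hs hW m
    set I := ∫ g, (matrixSeries A g ^ (2 * m)).trace.re
      ∂(Measure.pi fun _ : κ => gaussianReal 0 s)
    have hf : ((2 * (m + 1)).factorial : ℝ) = (2 * m + 2) * ((2 * m + 1) * (2 * m).factorial) := by
      rw [show 2 * (m + 1) = (2 * m + 1) + 1 by ring, Nat.factorial_succ, Nat.factorial_succ]
      push_cast; ring
    have hf' : ((m + 1).factorial : ℝ) = (m + 1) * m.factorial := by
      rw [Nat.factorial_succ]; push_cast; ring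
    calc _ ≤ ((2 * m + 1) * W * I) / (2 * (m + 1)).factorial :=
          div_le_div_of_nonneg_right h (by positivity)
      _ = W / (2 * (m + 1)) * (I / (2 * m).factorial) := by
          rw [hf]; field_simp
      _ ≤ W / (2 * (m + 1)) * (Fintype.card ι * ((W / 2) ^ m / m.factorial)) :=
          mul_le_mul_of_nonneg_left ih (by positivity)
      _ = _ := by rw [hf', pow_succ]; field_simp

end Series

/-! ### Tail bounds for matrix Gaussian series -/

/-- `tr cosh (β M)` for a Hermitian matrix `M`, as a series of extended nonnegative reals. -/
noncomputable def traceCosh {ι : Type*} [Fintype ι] [DecidableEq ι] (β : ℝ) (M : Matrix ι ι ℂ) :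
    ENNReal :=
  ∑' m : ℕ, ENNReal.ofReal (β ^ (2 * m) / (2 * m).factorial * (M ^ (2 * m)).trace.re)

section Tail

variable {κ ι : Type*} [Fintype κ] [Fintype ι] [DecidableEq ι]

lemma measurable_traceCosh_comp {Ω : Type*} [TopologicalSpace Ω] [MeasurableSpace Ω]
    [OpensMeasurableSpace Ω] {M : Ω → Matrix ι ι ℂ} (hM : Continuous M) (β : ℝ) :
    Measurable fun ω => traceCosh β (M ω) := by
  refine Measurable.tsum fun m => ?_
  have h : Continuous fun ω => (M ω ^ (2 * m)).trace.re :=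
    Complex.continuous_re.comp (hM.pow _).matrix_trace
  exact (h.measurable.const_mul _).ennreal_ofReal

/-- The matrix Laplace transform bound, summing the moment bounds. -/
lemma lintegral_traceCosh_matrixSeries_le {A : κ → Matrix ι ι ℂ} (hA : ∀ k, (A k).IsHermitian)
    {s : NNReal} (hs : s ≠ 0) {W : ℝ} (hW0 : 0 ≤ W)
    (hW : ∀ ψ : ι → ℂ, s * ∑ k, ∑ x, ‖(A k).mulVec ψ x‖ ^ 2 ≤ W * ∑ x, ‖ψ x‖ ^ 2) (β : ℝ) :
    ∫⁻ g, traceCosh β (matrixSeries A g) ∂(Measure.pi fun _ : κ => gaussianReal 0 s) ≤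
      ENNReal.ofReal (Fintype.card ι * Real.exp (β ^ 2 * W / 2)) := by
  set γ := Measure.pi fun _ : κ => gaussianReal 0 s with hγ
  have hint : ∀ m, Integrable (fun g => (matrixSeries A g ^ (2 * m)).trace.re) γ := fun m =>
    ((hasMoments_matrixSeries A s).pow _).integrable_re_trace
  have hpos : ∀ m g, 0 ≤ (matrixSeries A g ^ (2 * m)).trace.re := by
    intro m g
    have h := trace_conjTranspose_mul_self_re (matrixSeries A g ^ m)
    rw [Matrix.conjTranspose_pow, (isHermitian_matrixSeries hA g).eq, ← pow_add, ← two_mul] at h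
    rw [h]
    positivity
  let c : ℕ → ℝ := fun m => β ^ (2 * m) / (2 * m).factorial
  have hβ : ∀ m : ℕ, 0 ≤ β ^ (2 * m) := fun m => (even_two_mul m).pow_nonneg β
  have hc : ∀ m, 0 ≤ c m := fun m => div_nonneg (hβ m) (by positivity)
  have hmeas : ∀ m, AEMeasurable
      (fun g => ENNReal.ofReal (c m * (matrixSeries A g ^ (2 * m)).trace.re)) γ :=
    fun m => ((hint m).const_mul _).aemeasurable.ennreal_ofReal
  have hexp : HasSum (fun m : ℕ => (Fintype.card ι : ℝ) * ((β ^ 2 * W / 2) ^ m / m.factorial))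
      (Fintype.card ι * Real.exp (β ^ 2 * W / 2)) := by
    refine HasSum.mul_left _ ?_
    rw [Real.exp_eq_exp_ℝ]
    exact NormedSpace.expSeries_div_hasSum_exp _
  unfold traceCosh
  rw [lintegral_tsum hmeas, ← hexp.tsum_eq, ENNReal.ofReal_tsum_of_nonneg
    (fun m => by positivity) hexp.summable]
  refine ENNReal.tsum_le_tsum fun m => ?_
  rw [← ofReal_integral_eq_lintegral_ofReal ((hint m).const_mul _)
    (.of_forall fun g => mul_nonneg (hc m) (hpos m g)), integral_const_mul]
  refine ENNReal.ofReal_le_ofReal ?_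
  have h := mul_le_mul_of_nonneg_left (integral_re_trace_pow_le hA hs hW0 hW m) (hβ m)
  calc c m * ∫ g, (matrixSeries A g ^ (2 * m)).trace.re ∂γ
      = β ^ (2 * m) * ((∫ g, (matrixSeries A g ^ (2 * m)).trace.re ∂γ) /
        (2 * m).factorial) := by simp only [c]; ring
    _ ≤ _ := h
    _ = _ := by
      rw [mul_div_assoc (β ^ 2), mul_pow, pow_mul]
      ring

lemma exp_half_le_traceCosh {M : Matrix ι ι ℂ} (hM : M.IsHermitian) {ψ : ι → ℂ} (hψ : ψ ≠ 0)
    {t T β : ℝ} (he : M.mulVec ψ = (t : ℂ) • ψ) (hβ : 0 ≤ β) (ht : T ≤ t) :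
    ENNReal.ofReal (Real.exp (β * T) / 2) ≤ traceCosh β M := by
  have h1 : Real.exp (β * T) / 2 ≤ Real.cosh (β * t) := by
    rw [Real.cosh_eq]
    have : Real.exp (β * T) ≤ Real.exp (β * t) :=
      Real.exp_le_exp.2 (mul_le_mul_of_nonneg_left ht hβ)
    have := Real.exp_pos (-(β * t))
    linarith
  refine (ENNReal.ofReal_le_ofReal h1).trans ?_
  have hcosh := Real.hasSum_cosh (β * t)
  have hnn : ∀ m : ℕ, 0 ≤ (β * t) ^ (2 * m) / ((2 * m).factorial : ℝ) := fun m =>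
    div_nonneg ((even_two_mul m).pow_nonneg _) (by positivity)
  rw [← hcosh.tsum_eq, ENNReal.ofReal_tsum_of_nonneg hnn hcosh.summable]
  refine ENNReal.tsum_le_tsum fun m => ENNReal.ofReal_le_ofReal ?_
  have := mul_le_mul_of_nonneg_left (pow_le_re_trace_pow hM hψ he m)
    (by positivity : 0 ≤ β ^ (2 * m) / ((2 * m).factorial : ℝ))
  refine le_trans (le_of_eq ?_) this
  rw [mul_pow]
  ring

/-- Markov's inequality for `tr cosh (β M)`. -/
lemma measure_exists_eigenvalue_ge_le {Ω : Type*} [MeasurableSpace Ω] {μ : Measure Ω}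
    {M : Ω → Matrix ι ι ℂ} (hM : ∀ ω, (M ω).IsHermitian) {β L : ℝ} (hβ : 0 ≤ β)
    (hmeas : Measurable fun ω => traceCosh β (M ω))
    (hL : ∫⁻ ω, traceCosh β (M ω) ∂μ ≤ ENNReal.ofReal L) (T : ℝ) :
    μ {ω | ∃ t : ℝ, T ≤ t ∧ ∃ ψ, ψ ≠ 0 ∧ (M ω).mulVec ψ = (t : ℂ) • ψ} ≤
      ENNReal.ofReal (2 * L * Real.exp (-(β * T))) := by
  have hE : 0 < Real.exp (β * T) / 2 := by positivity
  have hmk := mul_meas_ge_le_lintegral₀ (μ := μ) hmeas.aemeasurable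
    (ENNReal.ofReal (Real.exp (β * T) / 2))
  calc _ ≤ μ {ω | ENNReal.ofReal (Real.exp (β * T) / 2) ≤ traceCosh β (M ω)} := by
        refine measure_mono ?_
        rintro ω ⟨t, ht, ψ, hψ, he⟩
        exact exp_half_le_traceCosh (hM ω) hψ he hβ ht
    _ ≤ (∫⁻ ω, traceCosh β (M ω) ∂μ) / ENNReal.ofReal (Real.exp (β * T) / 2) := by
        rw [ENNReal.le_div_iff_mul_le (Or.inl (by simpa using hE)) (Or.inl ENNReal.ofReal_ne_top),
          mul_comm]
        exact hmk
    _ ≤ ENNReal.ofReal L / ENNReal.ofReal (Real.exp (β * T) / 2) := ENNReal.div_le_div_right hL _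
    _ = _ := by
        rw [← ENNReal.ofReal_div_of_pos hE, Real.exp_neg]
        congr 1
        field_simp

/-- The scalar case: a one-sided tail bound for a linear combination of independent Gaussians. -/
lemma measure_sum_mul_le_neg_le (r : κ → ℝ) {s : NNReal} (hs : s ≠ 0) {W : ℝ}
    (hW : s * ∑ k, r k ^ 2 ≤ W) {β : ℝ} (hβ : 0 ≤ β) (T : ℝ) :
    (Measure.pi fun _ : κ => gaussianReal 0 s) {g | ∑ k, g k * r k ≤ -T} ≤
      ENNReal.ofReal (2 * Real.exp (β ^ 2 * W / 2) * Real.exp (-(β * T))) := by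
  let A : κ → Matrix Unit Unit ℂ := fun k => Matrix.of fun _ _ => ((-r k : ℝ) : ℂ)
  have hA : ∀ k, (A k).IsHermitian := fun k => by
    ext x y
    simp [A]
  have hW0 : 0 ≤ W := le_trans (by positivity) hW
  have hAW : ∀ ψ : Unit → ℂ, s * ∑ k, ∑ x, ‖(A k).mulVec ψ x‖ ^ 2 ≤ W * ∑ x, ‖ψ x‖ ^ 2 := by
    intro ψ
    simp only [Matrix.mulVec, dotProduct, A, Matrix.of_apply, Finset.univ_unique,
      Finset.sum_singleton, norm_mul, Complex.norm_real, mul_pow, Real.norm_eq_abs, sq_abs, neg_sq]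
    rw [← Finset.sum_mul, ← mul_assoc]
    exact mul_le_mul_of_nonneg_right hW (by positivity)
  have hcont : Continuous (matrixSeries A) := by
    unfold matrixSeries
    fun_prop
  have hmain := measure_exists_eigenvalue_ge_le (isHermitian_matrixSeries hA) hβ
    (measurable_traceCosh_comp hcont β) (lintegral_traceCosh_matrixSeries_le hA hs hW0 hAW β) T
  simp only [Fintype.card_unit, Nat.cast_one, one_mul] at hmain
  refine le_trans (measure_mono ?_) hmain
  intro g hg
  refine ⟨-∑ k, g k * r k, by simp only [Set.mem_ofPred_eq] at hg; linarith, fun _ => 1, ?_, ?_⟩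
  · exact fun h => one_ne_zero (congrFun h ())
  · funext x
    simp [matrixSeries, Matrix.mulVec, dotProduct, Matrix.sum_apply, A]

end Tail

/-! ### Hopping operators -/

open Classical in
/-- The operator `⊗ₐ |αₐ⟩⟨βₐ|` acting on the qudits `i a`, and the identity on the others. -/
noncomputable def hop {h N n : ℕ} (i : Fin h ↪ Fin n) (α β : Fin h → Fin N) :
    Matrix (Fin n → Fin N) (Fin n → Fin N) ℂ :=
  Matrix.of fun x y => if (∀ a, x (i a) = α a ∧ y (i a) = β a) ∧
    (∀ j, j ∉ Set.range i → x j = y j) then 1 else 0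

/-- The sum of `hop i α β` over all tuples `i` of distinct qudits. -/
noncomputable def hopSum {h N : ℕ} (n : ℕ) (α β : Fin h → Fin N) :
    Matrix (Fin n → Fin N) (Fin n → Fin N) ℂ :=
  ∑ i : Fin h ↪ Fin n, hop i α β

section Hop

variable {h N n : ℕ}

lemma extend_embedding_apply (i : Fin h ↪ Fin n) (β : Fin h → Fin N) (x : Fin n → Fin N)
    (a : Fin h) : Function.extend i β x (i a) = β a := i.injective.extend_apply β x a

lemma hop_condition_iff (i : Fin h ↪ Fin n) (α β : Fin h → Fin N) (x y : Fin n → Fin N) :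
    ((∀ a, x (i a) = α a ∧ y (i a) = β a) ∧ (∀ j, j ∉ Set.range i → x j = y j)) ↔
      x ∘ i = α ∧ y = Function.extend i β x := by
  constructor
  · rintro ⟨h1, h2⟩
    refine ⟨funext fun a => (h1 a).1, funext fun j => ?_⟩
    by_cases hj : j ∈ Set.range i
    · obtain ⟨a, rfl⟩ := hj
      rw [extend_embedding_apply, (h1 a).2]
    · rw [Function.extend_apply' _ _ _ hj, h2 j hj]
  · rintro ⟨rfl, rfl⟩
    refine ⟨fun a => ⟨rfl, extend_embedding_apply i β x a⟩, fun j hj => ?_⟩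
    rw [Function.extend_apply' _ _ _ hj]

lemma hop_mulVec (i : Fin h ↪ Fin n) (α β : Fin h → Fin N) (ψ : (Fin n → Fin N) → ℂ)
    (x : Fin n → Fin N) :
    (hop i α β).mulVec ψ x = if x ∘ i = α then ψ (Function.extend i β x) else 0 := by
  simp only [Matrix.mulVec, dotProduct, hop, Matrix.of_apply, hop_condition_iff, ite_and]
  split_ifs with hx <;> simp

lemma hop_conjTranspose (i : Fin h ↪ Fin n) (α β : Fin h → Fin N) :
    (hop i α β).conjTranspose = hop i β α := by
  ext x y
  simp only [Matrix.conjTranspose_apply, hop, Matrix.of_apply, apply_ite (star : ℂ → ℂ), star_one,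
    star_zero]
  congr 1
  simp only [and_comm, eq_comm]

/-- Exchanging the values of `x` on the qudits `i` with the tuple `β`. -/
noncomputable def exchange (i : Fin h ↪ Fin n) (z : (Fin n → Fin N) × (Fin h → Fin N)) :
    (Fin n → Fin N) × (Fin h → Fin N) :=
  (Function.extend i z.2 z.1, z.1 ∘ i)

lemma exchange_involutive (i : Fin h ↪ Fin n) :
    Function.Involutive (exchange (N := N) i) := by
  rintro ⟨x, β⟩
  simp only [exchange, Prod.mk.injEq]
  constructor
  · funext j
    by_cases hj : j ∈ Set.range i
    · obtain ⟨a, rfl⟩ := hj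
      rw [extend_embedding_apply, Function.comp_apply]
    · rw [Function.extend_apply' _ _ _ hj, Function.extend_apply' _ _ _ hj]
  · funext a
    rw [Function.comp_apply, extend_embedding_apply]

/-- Distinct tuples of qudits `i ≠ j` impose at least one independent equation on `β`. -/
lemma card_extend_comp_eq_le {i j : Fin h ↪ Fin n} (hij : i ≠ j) (x : Fin n → Fin N) :
    (Finset.univ.filter fun β : Fin h → Fin N => Function.extend i β x ∘ j = β).card ≤
      N ^ (h - 1) := by
  classical
  obtain ⟨a, ha⟩ : ∃ a, i a ≠ j a := by
    by_contra! hc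
    exact hij (DFunLike.ext _ _ hc)
  have hcard : Fintype.card ({b : Fin h // b ≠ a} → Fin N) = N ^ (h - 1) := by
    rw [Fintype.card_fun, Fintype.card_fin]
    simp
  rw [← hcard, ← Finset.card_univ]
  refine Finset.card_le_card_of_injOn (fun β b => β b.1) (by simp) ?_
  intro β hβ β' hβ' hEq
  simp only [Finset.coe_filter, Finset.mem_univ, true_and, Set.mem_ofPred_eq] at hβ hβ'
  have hne : ∀ b, b ≠ a → β b = β' b := fun b hb => congrFun hEq ⟨b, hb⟩
  funext b
  by_cases hb : b = a
  · subst hb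
    rw [← congrFun hβ b, ← congrFun hβ' b, Function.comp_apply, Function.comp_apply]
    by_cases hr : j b ∈ Set.range i
    · obtain ⟨c, hc⟩ := hr
      rw [← hc, extend_embedding_apply, extend_embedding_apply]
      exact hne c fun hcb => ha (hcb ▸ hc)
    · rw [Function.extend_apply' _ _ _ hr, Function.extend_apply' _ _ _ hr]
  · exact hne b hb

/-- The weight of the pair `(i, j)` in the matrix variance, after the change of variables that
exchanges `β` with the values of `x` on the qudits `i`. -/
lemma sum_exchange_le (i j : Fin h ↪ Fin n) (f : (Fin n → Fin N) → ℝ) :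
    ∑ x : Fin n → Fin N, ∑ β : Fin h → Fin N,
      (if x ∘ i = x ∘ j then f (Function.extend i β x) ^ 2 else 0) ≤
      ((if i = j then (N : ℝ) ^ h else 0) + (N : ℝ) ^ (h - 1)) * ∑ x, f x ^ 2 := by
  rw [← Fintype.sum_prod_type' (f := fun (x : Fin n → Fin N) (β : Fin h → Fin N) =>
    (if x ∘ i = x ∘ j then f (Function.extend i β x) ^ 2 else 0))]
  set e := Function.Involutive.toPerm _ (exchange_involutive (N := N) i) with he
  rw [← Equiv.sum_comp e]
  have hex : ∀ z : (Fin n → Fin N) × (Fin h → Fin N),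
      (if (e z).1 ∘ i = (e z).1 ∘ j then f (Function.extend i (e z).2 (e z).1) ^ 2 else 0) =
      if Function.extend i z.2 z.1 ∘ j = z.2 then f z.1 ^ 2 else 0 := by
    intro z
    have h1 : Function.extend i (e z).2 (e z).1 = z.1 :=
      congrArg Prod.fst (exchange_involutive i z)
    have h2 : (e z).1 ∘ i = z.2 := congrArg Prod.snd (exchange_involutive i z)
    rw [h1, h2]
    simp only [he, Function.Involutive.coe_toPerm, exchange, eq_comm]
  rw [Finset.sum_congr rfl fun z _ => hex z, Fintype.sum_prod_type, Finset.mul_sum]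
  refine Finset.sum_le_sum fun x _ => ?_
  dsimp only
  rw [← Finset.sum_filter, Finset.sum_const, nsmul_eq_mul]
  refine mul_le_mul_of_nonneg_right ?_ (sq_nonneg _)
  split_ifs with hij
  · have : (Finset.univ.filter fun β : Fin h → Fin N => Function.extend i β x ∘ j = β).card ≤
        N ^ h := (Finset.card_le_univ _).trans (by simp)
    have h' : ((Finset.univ.filter fun β : Fin h → Fin N =>
        Function.extend i β x ∘ j = β).card : ℝ) ≤ (N : ℝ) ^ h := by exact_mod_cast this
    have : (0 : ℝ) ≤ (N : ℝ) ^ (h - 1) := by positivity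
    linarith
  · rw [zero_add]
    exact_mod_cast card_extend_comp_eq_le hij x

/-- The bound on the matrix variance of the Hamiltonian: the number `D = n (n-1) ⋯ (n-h+1)` of
tuples times `N ^ h`, up to the relative error `D / N`. -/
noncomputable def varianceBound (h n N : ℕ) : ℝ :=
  (n.descFactorial h : ℝ) * (N : ℝ) ^ h + (n.descFactorial h : ℝ) ^ 2 * (N : ℝ) ^ (h - 1)

lemma varianceBound_nonneg (h n N : ℕ) : 0 ≤ varianceBound h n N := by
  unfold varianceBound; positivity

/-- Expanding the square gives a sum over pairs `(i, j)` of tuples; the diagonal contributes the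
leading order, and every other pair loses a factor `N`. -/
lemma sum_norm_hopSum_mulVec_le (ψ : (Fin n → Fin N) → ℂ) :
    ∑ α : Fin h → Fin N, ∑ β : Fin h → Fin N, ∑ x, ‖(hopSum n α β).mulVec ψ x‖ ^ 2 ≤
      varianceBound h n N * ∑ x, ‖ψ x‖ ^ 2 := by
  classical
  set f : (Fin n → Fin N) → ℝ := fun x => ‖ψ x‖ with hf
  have hval : ∀ (α β : Fin h → Fin N) x, ‖(hopSum n α β).mulVec ψ x‖ ≤
      ∑ i : Fin h ↪ Fin n, if x ∘ i = α then f (Function.extend i β x) else 0 := by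
    intro α β x
    rw [hopSum, Matrix.sum_mulVec, Finset.sum_apply]
    refine (norm_sum_le _ _).trans (Finset.sum_le_sum fun i _ => ?_)
    rw [hop_mulVec]
    split_ifs <;> simp [hf]
  have hsq : ∀ (α β : Fin h → Fin N) x, ‖(hopSum n α β).mulVec ψ x‖ ^ 2 ≤
      ∑ i : Fin h ↪ Fin n, ∑ j : Fin h ↪ Fin n,
        if x ∘ i = α then (if x ∘ j = α then
          (f (Function.extend i β x) ^ 2 + f (Function.extend j β x) ^ 2) / 2 else 0) else 0 := by
    intro α β x
    refine (pow_le_pow_left₀ (norm_nonneg _) (hval α β x) 2).trans ?_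
    rw [sq, Finset.sum_mul_sum]
    refine Finset.sum_le_sum fun i _ => Finset.sum_le_sum fun j _ => ?_
    split_ifs
    · nlinarith [sq_nonneg (f (Function.extend i β x) - f (Function.extend j β x))]
    all_goals simp
  -- the tuple `α` is determined by `x`, and both `i` and `j` must see it
  have hα : ∀ (β : Fin h → Fin N) x, ∑ α : Fin h → Fin N, ‖(hopSum n α β).mulVec ψ x‖ ^ 2 ≤
      ∑ i : Fin h ↪ Fin n, ∑ j : Fin h ↪ Fin n,
        if x ∘ i = x ∘ j then
          (f (Function.extend i β x) ^ 2 + f (Function.extend j β x) ^ 2) / 2 else 0 := by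
    intro β x
    refine (Finset.sum_le_sum fun α _ => hsq α β x).trans (le_of_eq ?_)
    rw [Finset.sum_comm]
    refine Finset.sum_congr rfl fun i _ => ?_
    rw [Finset.sum_comm]
    refine Finset.sum_congr rfl fun j _ => ?_
    rw [Finset.sum_ite_eq, if_pos (Finset.mem_univ _)]
    simp only [eq_comm]
  have hS : ∑ α : Fin h → Fin N, ∑ β : Fin h → Fin N, ∑ x, ‖(hopSum n α β).mulVec ψ x‖ ^ 2 ≤
      ∑ i : Fin h ↪ Fin n, ∑ j : Fin h ↪ Fin n, ∑ x : Fin n → Fin N, ∑ β : Fin h → Fin N,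
        (if x ∘ i = x ∘ j then
          (f (Function.extend i β x) ^ 2 + f (Function.extend j β x) ^ 2) / 2 else 0) := by
    calc _ = ∑ x, ∑ β : Fin h → Fin N, ∑ α : Fin h → Fin N,
          ‖(hopSum n α β).mulVec ψ x‖ ^ 2 := by
          rw [Finset.sum_comm, Finset.sum_congr rfl fun β _ => Finset.sum_comm, Finset.sum_comm]
      _ ≤ ∑ x, ∑ β : Fin h → Fin N, ∑ i : Fin h ↪ Fin n, ∑ j : Fin h ↪ Fin n,
          (if x ∘ i = x ∘ j then
          (f (Function.extend i β x) ^ 2 + f (Function.extend j β x) ^ 2) / 2 else 0) :=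
          Finset.sum_le_sum fun x _ => Finset.sum_le_sum fun β _ => hα β x
      _ = _ := by
          rw [Finset.sum_congr rfl fun x _ => Finset.sum_comm, Finset.sum_comm]
          refine Finset.sum_congr rfl fun i _ => ?_
          rw [Finset.sum_congr rfl fun x _ => Finset.sum_comm, Finset.sum_comm]
  refine hS.trans ?_
  -- after `2 a b ≤ a² + b²` the roles of `i` and `j` are exchanged in the second half
  have hij : ∀ i j : Fin h ↪ Fin n, ∑ x : Fin n → Fin N, ∑ β : Fin h → Fin N,
        (if x ∘ i = x ∘ j then
          (f (Function.extend i β x) ^ 2 + f (Function.extend j β x) ^ 2) / 2 else 0) ≤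
      ((if i = j then (N : ℝ) ^ h else 0) + (N : ℝ) ^ (h - 1)) * ∑ x, f x ^ 2 := by
    intro i j
    have h1 := sum_exchange_le i j f
    have h2 := sum_exchange_le j i f
    have h3 : ∑ x : Fin n → Fin N, ∑ β : Fin h → Fin N,
        (if x ∘ i = x ∘ j then
          (f (Function.extend i β x) ^ 2 + f (Function.extend j β x) ^ 2) / 2 else 0) =
        (∑ x : Fin n → Fin N, ∑ β : Fin h → Fin N,
          (if x ∘ i = x ∘ j then f (Function.extend i β x) ^ 2 else 0) +
        ∑ x : Fin n → Fin N, ∑ β : Fin h → Fin N,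
          (if x ∘ j = x ∘ i then f (Function.extend j β x) ^ 2 else 0)) / 2 := by
      rw [← Finset.sum_add_distrib, Finset.sum_div]
      refine Finset.sum_congr rfl fun x _ => ?_
      rw [← Finset.sum_add_distrib, Finset.sum_div]
      refine Finset.sum_congr rfl fun β _ => ?_
      by_cases hx : x ∘ i = x ∘ j
      · rw [if_pos hx, if_pos hx, if_pos hx.symm]
      · rw [if_neg hx, if_neg hx, if_neg (Ne.symm hx)]; simp
    have h4 : (if j = i then (N : ℝ) ^ h else 0) = if i = j then (N : ℝ) ^ h else 0 := by
      simp only [eq_comm]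
    rw [h4] at h2
    rw [h3]
    linarith
  refine (Finset.sum_le_sum fun i _ => Finset.sum_le_sum fun j _ => hij i j).trans (le_of_eq ?_)
  simp only [← Finset.sum_mul]
  congr 1
  simp only [Finset.sum_add_distrib, Finset.sum_ite_eq, Finset.mem_univ, if_true, Finset.sum_const,
    Finset.card_univ, Fintype.card_embedding_eq, Fintype.card_fin, nsmul_eq_mul, varianceBound]
  ring

end Hop

/-! ### The Hamiltonian of a single entry -/

section Hamiltonian

variable {p N : ℕ}

/-- Splitting the `p` indices of a tensor into the two halves. -/
noncomputable def halvesEquiv (hp : Even p) (N : ℕ) :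
    (Fin p → Fin N) ≃ (Fin (p / 2) → Fin N) × (Fin (p / 2) → Fin N) :=
  Equiv.ofBijective (fun μ => (μ ∘ firstHalf, μ ∘ secondHalf)) (by
    have h2 : p / 2 + p / 2 = p := by obtain ⟨m, rfl⟩ := hp; omega
    constructor
    · intro μ μ' hμ
      simp only [Prod.mk.injEq] at hμ
      funext k
      by_cases hk : k.1 < p / 2
      · exact congrFun hμ.1 ⟨k.1, hk⟩
      · have := congrFun hμ.2 ⟨k.1 - p / 2, by omega⟩
        have hk' : secondHalf (⟨k.1 - p / 2, by omega⟩ : Fin (p / 2)) = k := by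
          ext; simp only [secondHalf]; omega
        simpa only [Function.comp_apply, hk'] using this
    · rintro ⟨α, β⟩
      refine ⟨fun k => if hk : k.1 < p / 2 then α ⟨k.1, hk⟩ else β ⟨k.1 - p / 2, by omega⟩, ?_⟩
      simp only [Prod.mk.injEq]
      constructor
      · funext a
        simp [firstHalf]
      · funext a
        simp [secondHalf])

lemma sum_halves (hp : Even p) {M : Type*} [AddCommMonoid M]
    (F : (Fin (p / 2) → Fin N) → (Fin (p / 2) → Fin N) → M) :
    ∑ μ : Fin p → Fin N, F (μ ∘ firstHalf) (μ ∘ secondHalf) = ∑ α, ∑ β, F α β := by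
  rw [← Fintype.sum_prod_type' (f := F), ← Equiv.sum_comp (halvesEquiv hp N)]
  rfl

lemma hamiltonianTerm_eq (T : Tensor p N) (n : ℕ) (i : Fin (p / 2) ↪ Fin n) :
    hamiltonianTerm T n i =
      ∑ μ : Fin p → Fin N, T μ • hop i (μ ∘ firstHalf) (μ ∘ secondHalf) := by
  ext x y
  simp only [hamiltonianTerm, Matrix.of_apply, Matrix.sum_apply, Matrix.smul_apply, hop,
    smul_eq_mul, Function.comp_apply]

lemma hamiltonian_eq (T : Tensor p N) (n : ℕ) :
    hamiltonian T n = (1 / 2 : ℂ) • ∑ μ : Fin p → Fin N,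
      (T μ • hopSum n (μ ∘ firstHalf) (μ ∘ secondHalf) +
        star (T μ) • hopSum n (μ ∘ secondHalf) (μ ∘ firstHalf)) := by
  simp only [hamiltonian, hamiltonianTerm_eq, Matrix.conjTranspose_sum, Matrix.conjTranspose_smul,
    hop_conjTranspose, hopSum, Finset.smul_sum, ← Finset.sum_add_distrib]
  rw [Finset.sum_comm]

lemma isHermitian_hamiltonian (T : Tensor p N) (n : ℕ) : (hamiltonian T n).IsHermitian := by
  rw [Matrix.IsHermitian, hamiltonian, Matrix.conjTranspose_smul, Matrix.conjTranspose_sum]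
  congr 1
  · simp
  · refine Finset.sum_congr rfl fun i _ => ?_
    rw [Matrix.conjTranspose_add, Matrix.conjTranspose_conjTranspose, add_comm]

/-- The Hamiltonian is real linear in the tensor. -/
lemma hamiltonian_sum_smul {κ : Type*} (S : Finset κ) (r : κ → ℝ) (C : κ → Tensor p N) (n : ℕ) :
    hamiltonian (∑ k ∈ S, (r k : ℂ) • C k) n = ∑ k ∈ S, (r k : ℂ) • hamiltonian (C k) n := by
  simp only [hamiltonian_eq, Finset.smul_sum]
  rw [Finset.sum_comm]
  refine Finset.sum_congr rfl fun μ _ => ?_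
  simp only [Finset.sum_apply, Pi.smul_apply, smul_eq_mul, Finset.sum_smul, star_sum, smul_add,
    Finset.sum_add_distrib, Finset.smul_sum]
  congr 1
  · refine Finset.sum_congr rfl fun k _ => ?_
    simp only [smul_smul]
    ring_nf
  · refine Finset.sum_congr rfl fun k _ => ?_
    simp only [smul_smul, star_mul', Complex.star_def, Complex.conj_ofReal]
    ring_nf

lemma hamiltonian_single (μ : Fin p → Fin N) (c : ℂ) (n : ℕ) :
    hamiltonian (Pi.single μ c) n = (1 / 2 : ℂ) •
      (c • hopSum n (μ ∘ firstHalf) (μ ∘ secondHalf) +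
        star c • hopSum n (μ ∘ secondHalf) (μ ∘ firstHalf)) := by
  classical
  rw [hamiltonian_eq, Finset.sum_eq_single μ]
  · simp
  · intro ν _ hν
    simp [Pi.single_eq_of_ne hν]
  · simp

/-- The matrix variance of the noise in one real direction `c` of each entry. With
`B = hopSum α β`, the operator `(c B + c̄ Bᴴ) / 2` is controlled by `B` and `Bᴴ` through the
convexity of the square of the norm. -/
lemma sum_norm_hamiltonian_single_mulVec_le (hp : Even p) {c : ℂ} (hc : ‖c‖ ≤ 1) {n : ℕ}
    (ψ : (Fin n → Fin N) → ℂ) :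
    ∑ μ : Fin p → Fin N, ∑ x, ‖(hamiltonian (Pi.single μ c) n).mulVec ψ x‖ ^ 2 ≤
      varianceBound (p / 2) n N * ∑ x, ‖ψ x‖ ^ 2 := by
  have hpt : ∀ (μ : Fin p → Fin N) x, ‖(hamiltonian (Pi.single μ c) n).mulVec ψ x‖ ^ 2 ≤
      (‖(hopSum n (μ ∘ firstHalf) (μ ∘ secondHalf)).mulVec ψ x‖ ^ 2 +
        ‖(hopSum n (μ ∘ secondHalf) (μ ∘ firstHalf)).mulVec ψ x‖ ^ 2) / 2 := by
    intro μ x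
    rw [hamiltonian_single, Matrix.smul_mulVec, Matrix.add_mulVec, Matrix.smul_mulVec,
      Matrix.smul_mulVec]
    simp only [Pi.smul_apply, Pi.add_apply, smul_eq_mul]
    set u := (hopSum n (μ ∘ firstHalf) (μ ∘ secondHalf)).mulVec ψ x
    set w := (hopSum n (μ ∘ secondHalf) (μ ∘ firstHalf)).mulVec ψ x
    have h1 : ‖(1 / 2 : ℂ) * (c * u + star c * w)‖ ≤ (‖u‖ + ‖w‖) / 2 := by
      rw [norm_mul]
      have := norm_add_le (c * u) (star c * w)
      rw [norm_mul, norm_mul, norm_star] at this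
      have h2 : ‖c‖ * ‖u‖ ≤ ‖u‖ := mul_le_of_le_one_left (norm_nonneg _) hc
      have h3 : ‖c‖ * ‖w‖ ≤ ‖w‖ := mul_le_of_le_one_left (norm_nonneg _) hc
      have h4 : ‖(1 / 2 : ℂ)‖ = 1 / 2 := by norm_num
      rw [h4]
      linarith
    refine (pow_le_pow_left₀ (norm_nonneg _) h1 2).trans ?_
    nlinarith [sq_nonneg (‖u‖ - ‖w‖)]
  have hB := sum_norm_hopSum_mulVec_le (h := p / 2) ψ
  calc _ ≤ ∑ μ : Fin p → Fin N, ∑ x,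
      (‖(hopSum n (μ ∘ firstHalf) (μ ∘ secondHalf)).mulVec ψ x‖ ^ 2 +
        ‖(hopSum n (μ ∘ secondHalf) (μ ∘ firstHalf)).mulVec ψ x‖ ^ 2) / 2 :=
        Finset.sum_le_sum fun μ _ => Finset.sum_le_sum fun x _ => hpt μ x
    _ = (∑ α : Fin (p / 2) → Fin N, ∑ β : Fin (p / 2) → Fin N,
          ∑ x, ‖(hopSum n α β).mulVec ψ x‖ ^ 2 +
        ∑ α : Fin (p / 2) → Fin N, ∑ β : Fin (p / 2) → Fin N,
          ∑ x, ‖(hopSum n β α).mulVec ψ x‖ ^ 2) / 2 := by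
        rw [sum_halves hp (fun α β => ∑ x, (‖(hopSum n α β).mulVec ψ x‖ ^ 2 +
          ‖(hopSum n β α).mulVec ψ x‖ ^ 2) / 2)]
        simp only [← Finset.sum_div, Finset.sum_add_distrib]
    _ ≤ _ := by
        rw [Finset.sum_comm (f := fun (α β : Fin (p / 2) → Fin N) =>
          ∑ x, ‖(hopSum n β α).mulVec ψ x‖ ^ 2)]
        linarith

/-- The map applied to the tensor of independent entries. -/
noncomputable def Symmetrization.apply : Symmetrization → Tensor p N → Tensor p N
  | .none => id
  | .full => symmetrize

lemma symmetrize_single (μ : Fin p → Fin N) (c : ℂ) :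
    symmetrize (Pi.single μ c) = ∑ σ : Equiv.Perm (Fin p),
      (((p.factorial : ℝ)⁻¹ : ℝ) : ℂ) • (Pi.single (μ ∘ σ) c : Tensor p N) := by
  classical
  funext ν
  rw [symmetrize, Finset.sum_apply, Finset.mul_sum,
    ← Equiv.sum_comp (Equiv.inv (Equiv.Perm (Fin p)))]
  refine Finset.sum_congr rfl fun σ _ => ?_
  simp only [Pi.smul_apply, smul_eq_mul, Complex.ofReal_inv, Complex.ofReal_natCast]
  congr 1
  have : (ν ∘ (σ⁻¹ : Equiv.Perm (Fin p)) = μ) ↔ ν = μ ∘ σ := by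
    constructor
    · rintro rfl; funext a; simp
    · rintro rfl; funext a; simp
  simp only [Equiv.inv_apply, Pi.single_apply, this]

lemma sum_average_perm (Φ : (Fin p → Fin N) → ℝ) :
    ∑ μ, (p.factorial : ℝ)⁻¹ * ∑ σ : Equiv.Perm (Fin p), Φ (μ ∘ σ) = ∑ μ, Φ μ := by
  have h1 : ∀ σ : Equiv.Perm (Fin p), ∑ μ, Φ (μ ∘ σ) = ∑ μ, Φ μ := fun σ =>
    (σ.arrowCongr (Equiv.refl (Fin N))).symm.sum_comp Φ
  have hf : (p.factorial : ℝ) ≠ 0 := by positivity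
  rw [← Finset.mul_sum, Finset.sum_comm, Finset.sum_congr rfl fun σ _ => h1 σ, Finset.sum_const,
    Finset.card_univ, nsmul_eq_mul, Fintype.card_perm, Fintype.card_fin, ← mul_assoc,
    inv_mul_cancel₀ hf, one_mul]

/-- Symmetrization is an average of permutations of the entries, so it does not increase the matrix
variance. -/
lemma sum_norm_hamiltonian_apply_single_mulVec_le (hp : Even p) (sym : Symmetrization) {c : ℂ}
    (hc : ‖c‖ ≤ 1) {n : ℕ} (ψ : (Fin n → Fin N) → ℂ) :
    ∑ μ : Fin p → Fin N, ∑ x, ‖(hamiltonian (sym.apply (Pi.single μ c)) n).mulVec ψ x‖ ^ 2 ≤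
      varianceBound (p / 2) n N * ∑ x, ‖ψ x‖ ^ 2 := by
  have hbase := sum_norm_hamiltonian_single_mulVec_le hp hc ψ
  cases sym with
  | none => exact hbase
  | full =>
    have hcard : (Fintype.card (Equiv.Perm (Fin p)) : ℝ) = p.factorial := by
      rw [Fintype.card_perm, Fintype.card_fin]
    have hpt : ∀ (μ : Fin p → Fin N) x,
        ‖(hamiltonian (symmetrize (Pi.single μ c)) n).mulVec ψ x‖ ^ 2 ≤
        (p.factorial : ℝ)⁻¹ * ∑ σ : Equiv.Perm (Fin p),
          ‖(hamiltonian (Pi.single (μ ∘ σ) c) n).mulVec ψ x‖ ^ 2 := by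
      intro μ x
      rw [symmetrize_single, hamiltonian_sum_smul, Matrix.sum_mulVec, Finset.sum_apply]
      simp only [Matrix.smul_mulVec, Pi.smul_apply, smul_eq_mul]
      rw [← Finset.mul_sum, norm_mul, Complex.norm_real, Real.norm_of_nonneg (by positivity),
        mul_pow]
      have h1 : ‖∑ σ : Equiv.Perm (Fin p), (hamiltonian (Pi.single (μ ∘ σ) c) n).mulVec ψ x‖ ^ 2 ≤
          p.factorial * ∑ σ : Equiv.Perm (Fin p),
            ‖(hamiltonian (Pi.single (μ ∘ σ) c) n).mulVec ψ x‖ ^ 2 := by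
        refine (pow_le_pow_left₀ (norm_nonneg _) (norm_sum_le _ _) 2).trans ?_
        rw [← hcard]
        exact sq_sum_le_card_mul_sum_sq
      calc _ ≤ ((p.factorial : ℝ)⁻¹) ^ 2 * _ := mul_le_mul_of_nonneg_left h1 (by positivity)
        _ = _ := by field_simp
    set Φ : (Fin p → Fin N) → ℝ := fun μ =>
      ∑ x, ‖(hamiltonian (Pi.single μ c) n).mulVec ψ x‖ ^ 2 with hΦ
    have hsum : ∀ μ : Fin p → Fin N,
        ∑ x, ‖(hamiltonian (symmetrize (Pi.single μ c)) n).mulVec ψ x‖ ^ 2 ≤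
        (p.factorial : ℝ)⁻¹ * ∑ σ : Equiv.Perm (Fin p), Φ (μ ∘ σ) := by
      intro μ
      refine (Finset.sum_le_sum fun x _ => hpt μ x).trans (le_of_eq ?_)
      rw [← Finset.mul_sum, Finset.sum_comm]
    refine (Finset.sum_le_sum fun μ _ => hsum μ).trans ?_
    rw [sum_average_perm]
    exact hbase

end Hamiltonian

/-! ### The noise as a Gaussian series -/

section Noise

variable {p N : ℕ}

lemma symmetrize_sum_smul {κ : Type*} (S : Finset κ) (r : κ → ℂ) (C : κ → Tensor p N) :
    symmetrize (∑ k ∈ S, r k • C k) = ∑ k ∈ S, r k • symmetrize (C k) := by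
  funext μ
  simp only [symmetrize, Finset.sum_apply, Pi.smul_apply, smul_eq_mul, Finset.mul_sum]
  rw [Finset.sum_comm]
  refine Finset.sum_congr rfl fun k _ => Finset.sum_congr rfl fun σ _ => ?_
  ring

lemma Symmetrization.apply_sum_smul (sym : Symmetrization) {κ : Type*} (S : Finset κ) (r : κ → ℂ)
    (C : κ → Tensor p N) :
    sym.apply (∑ k ∈ S, r k • C k) = ∑ k ∈ S, r k • sym.apply (C k) := by
  cases sym with
  | none => rfl
  | full => exact symmetrize_sum_smul S r C

lemma Symmetrization.measurable_apply (sym : Symmetrization) :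
    Measurable (sym.apply : Tensor p N → Tensor p N) := by
  cases sym with
  | none => exact measurable_id
  | full =>
    unfold Symmetrization.apply symmetrize
    fun_prop

lemma measurable_tensorSeries {κ : Type*} [Fintype κ] (C : κ → Tensor p N) :
    Measurable fun g : κ → ℝ => ∑ k, (g k : ℂ) • C k := by
  refine measurable_pi_lambda _ fun μ => ?_
  simp only [Finset.sum_apply, Pi.smul_apply, smul_eq_mul]
  fun_prop

lemma noiseLaw_eq_map_apply (e : Ensemble) (sym : Symmetrization) (p N : ℕ) :
    noiseLaw e sym p N =
      (Measure.pi (fun _ : Fin p → Fin N => entryLaw e)).map sym.apply := by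
  cases sym with
  | none => exact Measure.map_id.symm
  | full => rfl

/-- The noise tensor is a Gaussian series `∑ₖ gₖ Cₖ`, whose coefficients are the symmetrized unit
tensors in the real ensemble, and these together with their multiples by `i` in the complex one.
The last clause says that the entries have total variance one: a quantity whose sum over the unit
tensors is at most `B` in every direction of the complex plane has variance at most `B`. -/
lemma exists_noiseLaw_eq_map_gaussian (e : Ensemble) (sym : Symmetrization) (p N : ℕ) :
    ∃ (κ : Type) (_ : Fintype κ) (v : NNReal) (C : κ → Tensor p N), v ≠ 0 ∧
      noiseLaw e sym p N = (Measure.pi fun _ : κ => gaussianReal 0 v).map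
        (fun g => ∑ k, (g k : ℂ) • C k) ∧
      ∀ (Q : Tensor p N → ℝ) (B : ℝ),
        (∀ c : ℂ, ‖c‖ ≤ 1 → ∑ μ : Fin p → Fin N, Q (sym.apply (Pi.single μ c)) ≤ B) →
        v * ∑ k, Q (C k) ≤ B := by
  classical
  cases e with
  | real =>
    refine ⟨Fin p → Fin N, inferInstance, 1, fun μ => sym.apply (Pi.single μ 1),
      one_ne_zero, ?_, ?_⟩
    · rw [noiseLaw_eq_map_apply, entryLaw]
      have h1 := Measure.pi_map_pi (μ := fun _ : Fin p → Fin N => gaussianReal 0 1)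
        (f := fun _ (x : ℝ) => (x : ℂ)) (fun _ => by fun_prop)
      rw [← h1, Measure.map_map sym.measurable_apply (by fun_prop)]
      congr 1
      funext g
      rw [← sym.apply_sum_smul, Function.comp_apply]
      congr 1
      funext μ
      simp [Finset.sum_apply, Pi.single_apply]
    · intro Q B h
      simpa using h 1 (by simp)
  | complex =>
    refine ⟨(Fin p → Fin N) ⊕ (Fin p → Fin N), inferInstance, 1 / 2,
      Sum.elim (fun μ => sym.apply (Pi.single μ 1)) (fun μ => sym.apply (Pi.single μ Complex.I)),
      by norm_num, ?_, ?_⟩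
    · rw [noiseLaw_eq_map_apply, entryLaw]
      have hmk : Measurable fun z : ℝ × ℝ => (⟨z.1, z.2⟩ : ℂ) :=
        Complex.measurableEquivRealProd.symm.measurable
      have : IsProbabilityMeasure (((gaussianReal 0 (1 / 2)).prod (gaussianReal 0 (1 / 2))).map
        (fun z : ℝ × ℝ => (⟨z.1, z.2⟩ : ℂ))) := Measure.isProbabilityMeasure_map hmk.aemeasurable
      have h1 := Measure.pi_map_pi
        (μ := fun _ : Fin p → Fin N => (gaussianReal 0 (1 / 2)).prod (gaussianReal 0 (1 / 2)))
        (f := fun _ (z : ℝ × ℝ) => (⟨z.1, z.2⟩ : ℂ)) (fun _ => hmk.aemeasurable)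
      have h2 := (measurePreserving_arrowProdEquivProdArrow ℝ ℝ (Fin p → Fin N)
        (fun _ => gaussianReal 0 (1 / 2)) (fun _ => gaussianReal 0 (1 / 2))).symm
      have h3 := measurePreserving_sumPiEquivProdPi
        (fun _ : (Fin p → Fin N) ⊕ (Fin p → Fin N) => gaussianReal 0 (1 / 2))
      rw [← h1, ← h2.map_eq, ← h3.map_eq]
      have hmk' : Measurable fun (z : (Fin p → Fin N) → ℝ × ℝ) μ => (⟨(z μ).1, (z μ).2⟩ : ℂ) :=
        measurable_pi_lambda _ fun μ => hmk.comp (measurable_pi_apply μ)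
      rw [Measure.map_map h2.measurable h3.measurable,
        Measure.map_map hmk' (h2.measurable.comp h3.measurable),
        Measure.map_map sym.measurable_apply (hmk'.comp (h2.measurable.comp h3.measurable))]
      congr 1
      funext g
      have hC : ∀ k, Sum.elim (fun μ => sym.apply (Pi.single μ 1 : Tensor p N))
          (fun μ => sym.apply (Pi.single μ Complex.I)) k = sym.apply (Sum.elim
          (fun μ => Pi.single μ 1) (fun μ => Pi.single μ Complex.I) k) := by
        rintro (μ | μ) <;> rfl
      simp only [hC]
      rw [← sym.apply_sum_smul, Function.comp_apply]
      congr 1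
      funext μ
      rw [Finset.sum_apply, Fintype.sum_sum_type]
      simp only [Sum.elim_inl, Sum.elim_inr, Pi.smul_apply, Pi.single_apply, smul_eq_mul, mul_ite,
        mul_one, mul_zero, Finset.sum_ite_eq, Finset.mem_univ, if_true]
      exact Complex.mk_eq_add_mul_I _ _
    · intro Q B h
      rw [Fintype.sum_sum_type]
      have h1 := h 1 (by simp)
      have h2 := h Complex.I (by simp)
      simp only [Sum.elim_inl, Sum.elim_inr]
      push_cast
      linarith

lemma isProbabilityMeasure_noiseLaw (e : Ensemble) (sym : Symmetrization) (p N : ℕ) :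
    IsProbabilityMeasure (noiseLaw e sym p N) := by
  obtain ⟨κ, _, v, C, _, hmap, -⟩ := exists_noiseLaw_eq_map_gaussian e sym p N
  rw [hmap]
  refine Measure.isProbabilityMeasure_map (measurable_tensorSeries C).aemeasurable

lemma continuous_hamiltonian (n : ℕ) : Continuous fun T : Tensor p N => hamiltonian T n := by
  simp only [hamiltonian_eq]
  fun_prop

/-- The upper tail of the spectrum of the noise Hamiltonian on the full space. -/
lemma noiseLaw_exists_eigenvalue_ge_le (hp : Even p) (e : Ensemble) (sym : Symmetrization) (n : ℕ)
    {W : ℝ} (hW : varianceBound (p / 2) n N ≤ W) {β : ℝ} (hβ : 0 ≤ β) (T : ℝ) :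
    noiseLaw e sym p N {G | ∃ t : ℝ, T ≤ t ∧ ∃ ψ, ψ ≠ 0 ∧
      (hamiltonian G n).mulVec ψ = (t : ℂ) • ψ} ≤
      ENNReal.ofReal (2 * ((N : ℝ) ^ n * Real.exp (β ^ 2 * W / 2)) * Real.exp (-(β * T))) := by
  obtain ⟨κ, _, v, C, hv, hmap, hB⟩ := exists_noiseLaw_eq_map_gaussian e sym p N
  have hmeas : Measurable fun T : Tensor p N => traceCosh β (hamiltonian T n) :=
    measurable_traceCosh_comp (continuous_hamiltonian n) β
  refine measure_exists_eigenvalue_ge_le (fun G => isHermitian_hamiltonian G n) hβ hmeas ?_ T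
  rw [hmap, lintegral_map hmeas (measurable_tensorSeries C)]
  simp only [hamiltonian_sum_smul]
  have h := lintegral_traceCosh_matrixSeries_le (A := fun k => hamiltonian (C k) n)
    (fun k => isHermitian_hamiltonian _ n) hv ((varianceBound_nonneg _ _ _).trans hW) (fun ψ => by
      refine (hB (fun T => ∑ x, ‖(hamiltonian T n).mulVec ψ x‖ ^ 2) _ fun c hc =>
        sum_norm_hamiltonian_apply_single_mulVec_le hp sym hc ψ).trans ?_
      exact mul_le_mul_of_nonneg_right hW (by positivity)) β
  refine h.trans (le_of_eq ?_)
  simp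

/-- The overlap of a tensor with `v^{⊗p}`. -/
noncomputable def overlap (v : EuclideanSpace ℝ (Fin N)) (T : Tensor p N) : ℝ :=
  (∑ μ : Fin p → Fin N, T μ * ((∏ a, v (μ a) : ℝ) : ℂ)).re

lemma overlap_symmetrize (v : EuclideanSpace ℝ (Fin N)) (T : Tensor p N) :
    overlap v (symmetrize T) = overlap v T := by
  have h1 : ∀ σ : Equiv.Perm (Fin p), ∑ μ : Fin p → Fin N,
      T (μ ∘ σ) * ((∏ a, v (μ a) : ℝ) : ℂ) =
      ∑ μ : Fin p → Fin N, T μ * ((∏ a, v (μ a) : ℝ) : ℂ) := by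
    intro σ
    rw [← (σ.arrowCongr (Equiv.refl (Fin N))).symm.sum_comp
      fun μ => T μ * ((∏ a, v (μ a) : ℝ) : ℂ)]
    refine Finset.sum_congr rfl fun μ _ => ?_
    congr 2
    exact (Equiv.prod_comp σ fun a => v (μ a)).symm
  have hf : (p.factorial : ℂ) ≠ 0 := Nat.cast_ne_zero.2 p.factorial_ne_zero
  unfold overlap
  congr 1
  simp only [symmetrize, mul_assoc, Finset.sum_mul]
  rw [← Finset.mul_sum, Finset.sum_comm, Finset.sum_congr rfl fun σ _ => h1 σ, Finset.sum_const,
    Finset.card_univ, nsmul_eq_mul, Fintype.card_perm, Fintype.card_fin, ← mul_assoc,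
    inv_mul_cancel₀ hf, one_mul]

lemma sum_prod_sq (v : EuclideanSpace ℝ (Fin N)) :
    ∑ μ : Fin p → Fin N, (∏ a, v (μ a)) ^ 2 = (‖v‖ ^ 2) ^ p := by
  rw [EuclideanSpace.norm_sq_eq, Finset.sum_pow']
  simp [Finset.prod_pow, Real.norm_eq_abs]

/-- The lower tail of the overlap of the noise with the signal. -/
lemma noiseLaw_overlap_le_neg_le (e : Ensemble) (sym : Symmetrization)
    (v : EuclideanSpace ℝ (Fin N)) {β : ℝ} (hβ : 0 ≤ β) (T : ℝ) :
    noiseLaw e sym p N {G | overlap v G ≤ -T} ≤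
      ENNReal.ofReal (2 * Real.exp (β ^ 2 * (‖v‖ ^ 2) ^ p / 2) * Real.exp (-(β * T))) := by
  classical
  obtain ⟨κ, _, s, C, hs, hmap, hB⟩ := exists_noiseLaw_eq_map_gaussian e sym p N
  have hov : Measurable fun G : Tensor p N => overlap v G := by
    unfold overlap
    fun_prop
  rw [hmap, Measure.map_apply (measurable_tensorSeries C) (measurableSet_le hov measurable_const)]
  have hlin : ∀ g : κ → ℝ, overlap v (∑ k, (g k : ℂ) • C k) = ∑ k, g k * overlap v (C k) := by
    intro g
    simp only [overlap, Finset.sum_apply, Pi.smul_apply, smul_eq_mul, Finset.sum_mul]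
    rw [Finset.sum_comm, Complex.re_sum]
    refine Finset.sum_congr rfl fun k _ => ?_
    simp only [mul_assoc]
    rw [← Finset.mul_sum, Complex.re_ofReal_mul]
  simp only [Set.preimage_ofPred_eq, hlin]
  refine measure_sum_mul_le_neg_le _ hs (hB (fun T => overlap v T ^ 2) _ fun c hc => ?_) hβ T
  have hap : ∀ T : Tensor p N, overlap v (sym.apply T) = overlap v T := by
    intro T
    cases sym with
    | none => rfl
    | full => exact overlap_symmetrize v T
  simp only [hap]
  rw [← sum_prod_sq]
  refine Finset.sum_le_sum fun μ _ => ?_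
  have : overlap v (Pi.single μ c : Tensor p N) = c.re * ∏ a, v (μ a) := by
    rw [overlap, Finset.sum_eq_single μ]
    · rw [Pi.single_eq_same, Complex.re_mul_ofReal]
    · intro ν _ hν
      rw [Pi.single_eq_of_ne hν, zero_mul]
    · simp
  rw [this, mul_pow]
  refine mul_le_of_le_one_left (sq_nonneg _) ?_
  rw [sq_le_one_iff_abs_le_one]
  exact (Complex.abs_re_le_norm c).trans hc

end Noise

/-! ### The signal: a variational lower bound -/

section Overlap

variable {h p n N : ℕ}

lemma prod_extend (i : Fin h ↪ Fin n) (g : Fin h → ℝ) (c : ℝ) :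
    ∏ j, Function.extend i g (fun _ => c) j = (∏ a, g a) * c ^ (n - h) := by
  classical
  rw [← Finset.prod_mul_prod_compl (Finset.univ.map i), Finset.prod_map]
  congr 1
  · exact Finset.prod_congr rfl fun a _ => i.injective.extend_apply _ _ a
  · have : ∀ j ∈ (Finset.univ.map i)ᶜ, Function.extend i g (fun _ => c) j = c := by
      intro j hj
      refine Function.extend_apply' _ _ _ ?_
      simpa using hj
    rw [Finset.prod_congr rfl this, Finset.prod_const, Finset.card_compl, Finset.card_map]
    simp

/-- The product state `v^{⊗n}`. -/
noncomputable def productState (n : ℕ) (v : EuclideanSpace ℝ (Fin N)) : (Fin n → Fin N) → ℂ :=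
  fun x => ((∏ j, v (x j) : ℝ) : ℂ)

lemma sum_norm_productState_sq (v : EuclideanSpace ℝ (Fin N)) :
    ∑ x, ‖productState n v x‖ ^ 2 = (‖v‖ ^ 2) ^ n := by
  rw [← sum_prod_sq]
  refine Finset.sum_congr rfl fun x _ => ?_
  rw [productState, Complex.norm_real, Real.norm_eq_abs, sq_abs]

/-- The expectation of a hopping operator in a product state factorizes over the qudits. -/
lemma sum_productState_mul_hop_mulVec (v : EuclideanSpace ℝ (Fin N)) (i : Fin h ↪ Fin n)
    (α β : Fin h → Fin N) :
    ∑ x, productState n v x * (hop i α β).mulVec (productState n v) x =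
      (((∏ a, v (α a)) * (∏ a, v (β a)) * (‖v‖ ^ 2) ^ (n - h) : ℝ) : ℂ) := by
  classical
  let F : Fin n → Fin N → ℝ := Function.extend i
    (fun a z => if z = α a then v (α a) * v (β a) else 0) (fun _ z => v z ^ 2)
  have hFi : ∀ a, F (i a) = fun z => if z = α a then v (α a) * v (β a) else 0 :=
    fun a => i.injective.extend_apply _ _ a
  have hFn : ∀ j, j ∉ Set.range i → F j = fun z => v z ^ 2 :=
    fun j hj => Function.extend_apply' _ _ _ hj
  have hpt : ∀ x : Fin n → Fin N,
      productState n v x * (hop i α β).mulVec (productState n v) x =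
        ((∏ j, F j (x j) : ℝ) : ℂ) := by
    intro x
    rw [hop_mulVec]
    split_ifs with hx
    · rw [productState, productState, ← Complex.ofReal_mul, ← Finset.prod_mul_distrib]
      congr 1
      refine Finset.prod_congr rfl fun j _ => ?_
      by_cases hj : j ∈ Set.range i
      · obtain ⟨a, rfl⟩ := hj
        have hxa : x (i a) = α a := congrFun hx a
        rw [extend_embedding_apply, hFi, hxa]
        exact (if_pos rfl).symm
      · rw [hFn j hj, Function.extend_apply' _ _ _ hj]
        exact (sq _).symm
    · obtain ⟨a, ha⟩ : ∃ a, x (i a) ≠ α a := by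
        by_contra! hc
        exact hx (funext hc)
      rw [mul_zero, Finset.prod_eq_zero (Finset.mem_univ (i a)), Complex.ofReal_zero]
      rw [hFi]
      exact if_neg ha
  have hG : ∀ j, ∑ z, F j z =
      Function.extend i (fun a => v (α a) * v (β a)) (fun _ => ‖v‖ ^ 2) j := by
    intro j
    by_cases hj : j ∈ Set.range i
    · obtain ⟨a, rfl⟩ := hj
      rw [hFi, i.injective.extend_apply]
      simp
    · rw [hFn j hj, Function.extend_apply' _ _ _ hj, EuclideanSpace.norm_sq_eq]
      simp [Real.norm_eq_abs]
  rw [Finset.sum_congr rfl fun x _ => hpt x, ← Complex.ofReal_sum]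
  congr 1
  rw [← Finset.prod_mul_distrib, ← prod_extend, ← Finset.prod_congr rfl fun j _ => hG j,
    Finset.prod_univ_sum, Fintype.piFinset_univ]

lemma prod_halves (hp : Even p) (f : Fin p → ℝ) :
    (∏ a, f (firstHalf a)) * ∏ a, f (secondHalf a) = ∏ a, f a := by
  have hb : Function.Bijective (Sum.elim (firstHalf (p := p)) secondHalf) := by
    rw [Fintype.bijective_iff_injective_and_card]
    constructor
    · rintro (a | a) (b | b) hab <;>
        simp only [Sum.elim_inl, Sum.elim_inr, firstHalf, secondHalf, Fin.mk.injEq] at hab <;>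
        first
        | (congr 1; ext; omega)
        | (have := a.2; have := b.2; omega)
    · obtain ⟨m, rfl⟩ := hp
      simp only [Fintype.card_sum, Fintype.card_fin]
      omega
  rw [← hb.prod_comp f, Fintype.prod_sum_type]
  rfl

/-- The expectation of the Hamiltonian in the product state `v^{⊗n}`. -/
lemma re_sum_productState_mul_hamiltonian (hp : Even p) (v : EuclideanSpace ℝ (Fin N))
    (T : Tensor p N) :
    (∑ x, star (productState n v x) * (hamiltonian T n).mulVec (productState n v) x).re =
      n.descFactorial (p / 2) * (‖v‖ ^ 2) ^ (n - p / 2) * overlap v T := by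
  have hstar : ∀ x, star (productState n v x) = productState n v x := fun x =>
    Complex.conj_ofReal _
  have hhop : ∀ α β : Fin (p / 2) → Fin N,
      ∑ x, productState n v x * (hopSum n α β).mulVec (productState n v) x =
      ((n.descFactorial (p / 2) * ((∏ a, v (α a)) * (∏ a, v (β a)) *
        (‖v‖ ^ 2) ^ (n - p / 2)) : ℝ) : ℂ) := by
    intro α β
    simp only [hopSum, Matrix.sum_mulVec, Finset.sum_apply, Finset.mul_sum]
    rw [Finset.sum_comm, Finset.sum_congr rfl fun i _ => sum_productState_mul_hop_mulVec v i α β,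
      Finset.sum_const, Finset.card_univ, Fintype.card_embedding_eq, Fintype.card_fin,
      Fintype.card_fin, nsmul_eq_mul]
    push_cast
    ring
  have hprod : ∀ μ : Fin p → Fin N,
      (∏ a, v ((μ ∘ firstHalf) a)) * (∏ a, v ((μ ∘ secondHalf) a)) = ∏ a, v (μ a) :=
    fun μ => prod_halves hp fun a => v (μ a)
  have hprod' : ∀ μ : Fin p → Fin N,
      (∏ a, v ((μ ∘ secondHalf) a)) * (∏ a, v ((μ ∘ firstHalf) a)) = ∏ a, v (μ a) :=
    fun μ => by rw [mul_comm, hprod]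
  have hsum : ∑ x, star (productState n v x) * (hamiltonian T n).mulVec (productState n v) x =
      ∑ μ : Fin p → Fin N, (1 / 2 : ℂ) * ((T μ + star (T μ)) *
        ((n.descFactorial (p / 2) * ((∏ a, v (μ a)) * (‖v‖ ^ 2) ^ (n - p / 2)) : ℝ) : ℂ)) := by
    simp only [hstar, hamiltonian_eq, Matrix.smul_mulVec, Matrix.sum_mulVec, Matrix.add_mulVec,
      Pi.smul_apply, Finset.sum_apply, Pi.add_apply, smul_eq_mul, Finset.mul_sum]
    rw [Finset.sum_comm]
    refine Finset.sum_congr rfl fun μ _ => ?_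
    have h1 := hhop (μ ∘ firstHalf) (μ ∘ secondHalf)
    have h2 := hhop (μ ∘ secondHalf) (μ ∘ firstHalf)
    rw [hprod] at h1
    rw [hprod'] at h2
    rw [add_mul]
    nth_rewrite 1 [← h1]
    rw [← h2]
    simp only [Finset.mul_sum, ← Finset.sum_add_distrib]
    refine Finset.sum_congr rfl fun x _ => ?_
    ring
  rw [hsum, Complex.re_sum, overlap, Complex.re_sum, Finset.mul_sum]
  refine Finset.sum_congr rfl fun μ _ => ?_
  have : T μ + star (T μ) = ((2 * (T μ).re : ℝ) : ℂ) := Complex.add_conj _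
  rw [this, Complex.re_mul_ofReal, ← Complex.ofReal_mul,
    show (1 / 2 : ℂ) = ((1 / 2 : ℝ) : ℂ) by norm_num, ← Complex.ofReal_mul, Complex.ofReal_re]
  ring

lemma productState_mem_symmetricSubspace (v : EuclideanSpace ℝ (Fin N)) :
    productState n v ∈ symmetricSubspace N n := by
  intro σ x
  simp only [productState, Function.comp_apply]
  rw [Equiv.prod_comp σ fun j => v (x j)]

lemma hamiltonianTerm_perm (T : Tensor p N) (i : Fin (p / 2) ↪ Fin n) (σ : Equiv.Perm (Fin n))
    (x y : Fin n → Fin N) :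
    hamiltonianTerm T n i (x ∘ σ) (y ∘ σ) = hamiltonianTerm T n (i.trans σ.toEmbedding) x y := by
  have h : (∀ j, j ∉ Set.range i → (x ∘ σ) j = (y ∘ σ) j) ↔
      (∀ j, j ∉ Set.range (i.trans σ.toEmbedding) → x j = y j) := by
    rw [← σ.forall_congr_right (q := fun j => j ∉ Set.range (i.trans σ.toEmbedding) → x j = y j)]
    simp [Set.mem_range]
  simp only [hamiltonianTerm, Matrix.of_apply]
  refine Finset.sum_congr rfl fun μ _ => ?_
  exact congrArg (T μ * ·) (if_congr (and_congr Iff.rfl h) rfl rfl)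

lemma hamiltonian_perm (T : Tensor p N) (σ : Equiv.Perm (Fin n)) (x y : Fin n → Fin N) :
    hamiltonian T n (x ∘ σ) (y ∘ σ) = hamiltonian T n x y := by
  simp only [hamiltonian, Matrix.smul_apply, Matrix.sum_apply, Matrix.add_apply,
    Matrix.conjTranspose_apply, hamiltonianTerm_perm]
  congr 1
  exact (Equiv.embeddingCongr (Equiv.refl _) σ).sum_comp fun i =>
    hamiltonianTerm T n i x y + star (hamiltonianTerm T n i y x)

/-- The Hamiltonian is invariant under permutations of the qudits. -/
lemma hamiltonian_mulVec_mem (T : Tensor p N) (sec : Sector) {ψ : (Fin n → Fin N) → ℂ}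
    (hψ : ψ ∈ sec.space N n) : (hamiltonian T n).mulVec ψ ∈ sec.space N n := by
  cases sec with
  | full => trivial
  | symmetric =>
    intro σ x
    simp only [Matrix.mulVec, dotProduct]
    rw [← (σ.symm.arrowCongr (Equiv.refl (Fin N))).sum_comp]
    refine Finset.sum_congr rfl fun y _ => ?_
    rw [show (σ.symm.arrowCongr (Equiv.refl (Fin N))) y = y ∘ σ from rfl, hamiltonian_perm,
      hψ σ y]

lemma productState_mem_space (sec : Sector) (v : EuclideanSpace ℝ (Fin N)) :
    productState n v ∈ sec.space N n := by
  cases sec with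
  | full => trivial
  | symmetric => exact productState_mem_symmetricSubspace v

end Overlap

section Rayleigh

variable {ι : Type} [Fintype ι] [DecidableEq ι]

lemma bddAbove_eigenvalues {M : Matrix ι ι ℂ} (hM : M.IsHermitian) (S : Submodule ℂ (ι → ℂ)) :
    BddAbove {t : ℝ | ∃ ψ ∈ S, ψ ≠ 0 ∧ M.mulVec ψ = (t : ℂ) • ψ} := by
  refine ⟨1 + (M ^ 2).trace.re, ?_⟩
  rintro t ⟨ψ, _, hψ, he⟩
  have := pow_le_re_trace_pow hM hψ he 1
  rw [mul_one] at this
  nlinarith [sq_nonneg (t - 1)]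

/-- The variational principle on an invariant subspace. -/
lemma re_sum_mul_mulVec_le {M : Matrix ι ι ℂ} (hM : M.IsHermitian) {S : Submodule ℂ (ι → ℂ)}
    (hS : ∀ ψ ∈ S, M.mulVec ψ ∈ S) {φ : ι → ℂ} (hφ : φ ∈ S) :
    (∑ x, star (φ x) * M.mulVec φ x).re ≤ leadingEigenvalue M S * ∑ x, ‖φ x‖ ^ 2 := by
  by_cases hφ0 : φ = 0
  · simp [hφ0]
  let S' : Submodule ℂ (EuclideanSpace ℂ ι) :=
    S.comap (WithLp.linearEquiv 2 ℂ (ι → ℂ)).toLinearMap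
  let L := Matrix.toEuclideanLin M
  have hL : L.IsSymmetric := Matrix.isSymmetric_toEuclideanLin_iff.2 hM
  have hinv : ∀ w ∈ S', L w ∈ S' := fun w hw => hS _ hw
  have hR := hL.restrict_invariant hinv
  let w : S' := ⟨WithLp.toLp 2 φ, hφ⟩
  have hw : w ≠ 0 := by
    intro hw0
    apply hφ0
    have := congrArg (fun u : S' => (u : EuclideanSpace ℂ ι).ofLp) hw0
    simpa [w] using this
  have : Nontrivial S' := ⟨w, 0, hw⟩
  have hev := hR.hasEigenvalue_iSup_of_finiteDimensional
  set lam : ℝ := ⨆ x : { x : S' // x ≠ 0 },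
    RCLike.re (inner ℂ (L.restrict hinv x) (x : S')) / ‖(x : S')‖ ^ 2 with hlam
  have hle : lam ≤ leadingEigenvalue M S := by
    obtain ⟨u, hu⟩ := hev.exists_hasEigenvector
    refine le_csSup (bddAbove_eigenvalues hM S) ⟨(u : EuclideanSpace ℂ ι).ofLp, u.2, ?_, ?_⟩
    · intro h0
      apply hu.2
      ext x
      exact congrFun h0 x
    · have := hu.apply_eq_smul
      exact congrArg (fun u : S' => (u : EuclideanSpace ℂ ι).ofLp) this
  have hbdd : BddAbove (Set.range fun x : { x : S' // x ≠ 0 } =>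
      RCLike.re (inner ℂ (L.restrict hinv x) (x : S')) / ‖(x : S')‖ ^ 2) := by
    let Lc := LinearMap.toContinuousLinearMap (L.restrict hinv)
    refine ⟨‖Lc‖, ?_⟩
    rintro _ ⟨⟨x, hx⟩, rfl⟩
    have hx' : 0 < ‖x‖ ^ 2 := by positivity
    rw [div_le_iff₀ hx']
    calc _ ≤ ‖Lc x‖ * ‖x‖ := (RCLike.re_le_norm _).trans (norm_inner_le_norm (𝕜 := ℂ) (Lc x) x)
      _ ≤ (‖Lc‖ * ‖x‖) * ‖x‖ := by gcongr; exact Lc.le_opNorm x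
      _ = _ := by ring
  have hq := le_ciSup hbdd ⟨w, hw⟩
  have hnorm : ‖w‖ ^ 2 = ∑ x, ‖φ x‖ ^ 2 := by
    rw [Submodule.coe_norm, EuclideanSpace.norm_sq_eq]
  have hinner : RCLike.re (inner ℂ (L.restrict hinv w) w) =
      (∑ x, star (φ x) * M.mulVec φ x).re := by
    rw [hR w w, Submodule.coe_inner, PiLp.inner_apply]
    simp only [RCLike.inner_apply, RCLike.re_eq_complex_re]
    congr 1
    refine Finset.sum_congr rfl fun x _ => ?_
    rw [mul_comm]
    rfl
  have hpos : 0 < ‖w‖ ^ 2 := by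
    have := norm_pos_iff.2 hw
    positivity
  rw [← hinner, ← hnorm]
  exact ((div_le_iff₀ hpos).1 hq).trans (mul_le_mul_of_nonneg_right hle hpos.le)

end Rayleigh

/-! ### Error probabilities of the detection step -/

section Detection

variable {p N : ℕ}

lemma spikedTensor_zero (v : EuclideanSpace ℝ (Fin N)) (G : Tensor p N) :
    spikedTensor 0 v G = G := by
  funext μ
  simp [spikedTensor]

lemma overlap_spikedTensor (lam : ℝ) (v : EuclideanSpace ℝ (Fin N)) (G : Tensor p N) :
    overlap v (spikedTensor lam v G) = lam * (‖v‖ ^ 2) ^ p + overlap v G := by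
  simp only [overlap, spikedTensor, add_mul, Finset.sum_add_distrib, Complex.add_re]
  congr 1
  rw [← sum_prod_sq, Finset.mul_sum, Complex.re_sum]
  refine Finset.sum_congr rfl fun μ _ => ?_
  rw [← Complex.ofReal_prod, ← Complex.ofReal_mul, ← Complex.ofReal_mul, Complex.ofReal_re]
  ring

/-- The probability of a false alarm. -/
lemma measure_reportsSignal_zero_le (hp : Even p) (e : Ensemble) (sym : Symmetrization)
    (sec : Sector) (n : ℕ) {lam : ℝ} (ν : Measure (EuclideanSpace ℝ (Fin N)))
    [IsProbabilityMeasure ν] (hcut : 0 ≤ energyCut e p n N lam) {W : ℝ}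
    (hW : varianceBound (p / 2) n N ≤ W) {β : ℝ} (hβ : 0 ≤ β) :
    (ν.prod (noiseLaw e sym p N))
      {ω | ReportsSignal e sec n lam (spikedTensor 0 ω.1 ω.2)} ≤
      ENNReal.ofReal (2 * ((N : ℝ) ^ n * Real.exp (β ^ 2 * W / 2)) *
        Real.exp (-(β * energyCut e p n N lam))) := by
  have := isProbabilityMeasure_noiseLaw e sym p N
  refine le_trans ?_ (noiseLaw_exists_eigenvalue_ge_le hp e sym n hW hβ (energyCut e p n N lam))
  set A := {G : Tensor p N | ∃ t : ℝ, energyCut e p n N lam ≤ t ∧ ∃ ψ, ψ ≠ 0 ∧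
      (hamiltonian G n).mulVec ψ = (t : ℂ) • ψ}
  have hsub : {ω : EuclideanSpace ℝ (Fin N) × Tensor p N |
      ReportsSignal e sec n lam (spikedTensor 0 ω.1 ω.2)} ⊆ Set.univ ×ˢ A := by
    rintro ⟨v, G⟩ h
    refine ⟨trivial, ?_⟩
    change energyCut e p n N lam < leadingEigenvalue (hamiltonian (spikedTensor 0 v G) n) _ at h
    rw [spikedTensor_zero] at h
    -- a vacuous supremum is zero, hence below the threshold
    have hne : {t : ℝ | ∃ ψ ∈ sec.space N n, ψ ≠ 0 ∧
        (hamiltonian G n).mulVec ψ = (t : ℂ) • ψ}.Nonempty := by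
      by_contra hc
      rw [Set.not_nonempty_iff_eq_empty] at hc
      rw [leadingEigenvalue, hc, Real.sSup_empty] at h
      linarith
    obtain ⟨t, ⟨ψ, _, hψ, he⟩, ht⟩ := exists_lt_of_lt_csSup hne h
    exact ⟨t, ht.le, ψ, hψ, he⟩
  refine (measure_mono hsub).trans ?_
  rw [Measure.prod_prod, measure_univ, one_mul]

lemma energyZero_eq (p n N : ℕ) (lam : ℝ) :
    energyZero p n N lam = lam * n.descFactorial (p / 2) * (N : ℝ) ^ (p / 2) := by
  rw [energyZero, Nat.descFactorial_eq_factorial_mul_choose]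
  push_cast
  ring

/-- The probability of a missed signal. The product state of the signal has energy at least
`E₀` plus the fluctuating contribution of the noise. -/
lemma measure_not_reportsSignal_le (hp : Even p) (e : Ensemble) (sym : Symmetrization)
    (sec : Sector) {n : ℕ} (lam : ℝ) (ν : Measure (EuclideanSpace ℝ (Fin N)))
    [IsProbabilityMeasure ν] (hν : ∀ᵐ v ∂ν, ‖v‖ = √(N : ℝ)) (hN : 0 < N) (hn : p / 2 ≤ n) :
    (ν.prod (noiseLaw e sym p N))
      {ω | ¬ ReportsSignal e sec n lam (spikedTensor lam ω.1 ω.2)} ≤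
      ENNReal.ofReal (2 * Real.exp (1 / 2) * Real.exp (-((energyZero p n N lam -
        energyMax e p n N) / 2 / n.descFactorial (p / 2)))) := by
  have := isProbabilityMeasure_noiseLaw e sym p N
  have h2 : p / 2 + p / 2 = p := by obtain ⟨m, rfl⟩ := hp; omega
  have hN' : (0 : ℝ) < N := by exact_mod_cast hN
  have hD : (0 : ℝ) < n.descFactorial (p / 2) := by
    exact_mod_cast Nat.descFactorial_pos.2 hn
  set D : ℝ := (n.descFactorial (p / 2) : ℝ) with hDdef
  set S : ℝ := (energyZero p n N lam - energyMax e p n N) / 2 with hS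
  set T : ℝ := S / D * (N : ℝ) ^ (p / 2) with hT
  set B : Set (EuclideanSpace ℝ (Fin N) × Tensor p N) :=
    {ω | ‖ω.1‖ = √(N : ℝ) ∧ overlap ω.1 ω.2 ≤ -T} with hB
  set Z : Set (EuclideanSpace ℝ (Fin N) × Tensor p N) :=
    {v | ¬ ‖v‖ = √(N : ℝ)} ×ˢ Set.univ with hZ
  have hsub : {ω : EuclideanSpace ℝ (Fin N) × Tensor p N |
      ¬ ReportsSignal e sec n lam (spikedTensor lam ω.1 ω.2)} ⊆ B ∪ Z := by
    rintro ⟨v, G⟩ h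
    by_cases hv : ‖v‖ = √(N : ℝ)
    swap
    · exact Or.inr ⟨hv, trivial⟩
    refine Or.inl ⟨hv, ?_⟩
    have hv2 : ‖v‖ ^ 2 = N := by rw [hv, Real.sq_sqrt hN'.le]
    have hle := re_sum_mul_mulVec_le (isHermitian_hamiltonian (spikedTensor lam v G) n)
      (fun ψ hψ => hamiltonian_mulVec_mem (spikedTensor lam v G) sec hψ)
      (productState_mem_space sec v)
    rw [re_sum_productState_mul_hamiltonian hp, sum_norm_productState_sq, overlap_spikedTensor,
      hv2] at hle
    have h' : leadingEigenvalue (hamiltonian (spikedTensor lam v G) n) (sec.space N n) ≤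
      energyCut e p n N lam := not_lt.1 h
    have hle2 := hle.trans (mul_le_mul_of_nonneg_right h' (by positivity))
    have hpw : (N : ℝ) ^ n = (N : ℝ) ^ (n - p / 2) * (N : ℝ) ^ (p / 2) := by
      rw [← pow_add, Nat.sub_add_cancel hn]
    have hpw2 : (N : ℝ) ^ p = (N : ℝ) ^ (p / 2) * (N : ℝ) ^ (p / 2) := by rw [← pow_add, h2]
    have hK : (0 : ℝ) < (N : ℝ) ^ (n - p / 2) := by positivity
    have hH : (0 : ℝ) < (N : ℝ) ^ (p / 2) := by positivity
    have h3 : D * (lam * (N : ℝ) ^ p + overlap v G) ≤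
        energyCut e p n N lam * (N : ℝ) ^ (p / 2) := by
      refine le_of_mul_le_mul_left ?_ hK
      calc _ = D * (N : ℝ) ^ (n - p / 2) * (lam * (N : ℝ) ^ p + overlap v G) := by ring
        _ ≤ _ := hle2
        _ = _ := by rw [hpw]; ring
    have h4 : energyCut e p n N lam = lam * D * (N : ℝ) ^ (p / 2) - S := by
      rw [energyCut, hS, energyZero_eq]
      ring
    rw [h4, hpw2] at h3
    have h5 : D * overlap v G ≤ D * (-T) := by
      have : D * (-T) = -(S * (N : ℝ) ^ (p / 2)) := by
        rw [hT]; field_simp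
      rw [this]
      nlinarith
    exact le_of_mul_le_mul_left h5 hD
  have hZ0 : (ν.prod (noiseLaw e sym p N)) Z = 0 := by
    rw [hZ, Measure.prod_prod, ae_iff.1 hν, zero_mul]
  have hBm : MeasurableSet B := by
    have hov : Measurable fun ω : EuclideanSpace ℝ (Fin N) × Tensor p N => overlap ω.1 ω.2 := by
      unfold overlap
      fun_prop
    exact (measurableSet_eq_fun (by fun_prop) measurable_const).inter
      (measurableSet_le hov measurable_const)
  have hBle : (ν.prod (noiseLaw e sym p N)) B ≤
      ENNReal.ofReal (2 * Real.exp (1 / 2) * Real.exp (-(S / D))) := by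
    rw [Measure.prod_apply hBm]
    calc _ ≤ ∫⁻ _v, ENNReal.ofReal (2 * Real.exp (1 / 2) * Real.exp (-(S / D))) ∂ν := by
          refine lintegral_mono fun v => ?_
          by_cases hv : ‖v‖ = √(N : ℝ)
          swap
          · have : Prod.mk v ⁻¹' B = ∅ := by
              ext G
              simp [hB, hv]
            simp [this]
          have hv2 : ‖v‖ ^ 2 = N := by rw [hv, Real.sq_sqrt hN'.le]
          -- the overlap has standard deviation at most `N ^ (p / 2)`, the inverse of `β`
          have hmain := noiseLaw_overlap_le_neg_le (p := p) e sym v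
            (by positivity : 0 ≤ 1 / (N : ℝ) ^ (p / 2)) T
          have hpw2 : (N : ℝ) ^ p = (N : ℝ) ^ (p / 2) * (N : ℝ) ^ (p / 2) := by rw [← pow_add, h2]
          have e1 : (1 / (N : ℝ) ^ (p / 2)) ^ 2 * (N : ℝ) ^ p / 2 = 1 / 2 := by
            rw [hpw2]; field_simp
          have e2 : 1 / (N : ℝ) ^ (p / 2) * T = S / D := by
            rw [hT]; field_simp
          rw [hv2, e1, e2] at hmain
          refine (measure_mono ?_).trans hmain
          intro G hG
          exact hG.2
      _ = _ := by rw [lintegral_const, measure_univ, mul_one]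
  calc _ ≤ (ν.prod (noiseLaw e sym p N)) (B ∪ Z) := measure_mono hsub
    _ ≤ _ := measure_union_le _ _
    _ ≤ _ := by rw [hZ0, add_zero]; exact hBle

end Detection

/-! ### Asymptotics of the thresholds -/

/-- The scale `J n^{p/2} N^{p/2}` of the matrix variance. -/
noncomputable def varianceScale (e : Ensemble) (p n N : ℕ) : ℝ :=
  scalarJ e p n N * (n : ℝ) ^ (p / 2) * (N : ℝ) ^ (p / 2)

section Thresholds

variable {p n N : ℕ}

lemma scalarJ_nonneg (e : Ensemble) (p n N : ℕ) : 0 ≤ scalarJ e p n N := by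
  have : 0 ≤ e.factor := by cases e <;> simp [Ensemble.factor]
  unfold scalarJ leadingJ
  positivity

lemma descFactorial_mul_pow_le_varianceScale (e : Ensemble) (hn : p / 2 ≤ n) (hn0 : 0 < n)
    (hN : 0 < N) :
    (n.descFactorial (p / 2) : ℝ) * (N : ℝ) ^ (p / 2) ≤ varianceScale e p n N := by
  have hc : 1 ≤ e.factor := by cases e <;> simp [Ensemble.factor]
  have hn' : (0 : ℝ) < n := by exact_mod_cast hn0
  have hN' : (0 : ℝ) < N := by exact_mod_cast hN
  have h1 : N ^ (p / 2) ≤ (N + n - 1).descFactorial (p / 2) := by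
    refine le_trans (Nat.pow_le_pow_left ?_ _) (Nat.pow_sub_le_descFactorial _ _)
    omega
  have h1' : (N : ℝ) ^ (p / 2) ≤ ((N + n - 1).descFactorial (p / 2) : ℝ) := by exact_mod_cast h1
  have e1 : varianceScale e p n N = e.factor * (n.descFactorial (p / 2) : ℝ) *
      ((N + n - 1).descFactorial (p / 2) : ℝ) := by
    rw [varianceScale, scalarJ, leadingJ, Nat.descFactorial_eq_factorial_mul_choose n]
    push_cast
    field_simp
  rw [e1]
  have h2 : (0 : ℝ) ≤ n.descFactorial (p / 2) := by positivity
  calc _ = 1 * (n.descFactorial (p / 2) : ℝ) * (N : ℝ) ^ (p / 2) := by ring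
    _ ≤ _ := by gcongr

lemma rpow_quarter_eq_sqrt (hp : Even p) {x : ℝ} (hx : 0 ≤ x) :
    x ^ ((p : ℝ) / 4) = √(x ^ (p / 2)) := by
  have h2 : ((p / 2 : ℕ) : ℝ) = (p : ℝ) / 2 := by
    rw [Nat.cast_div hp.two_dvd (by norm_num)]; norm_num
  rw [Real.sqrt_eq_rpow, ← Real.rpow_natCast, ← Real.rpow_mul hx, h2]
  congr 1
  ring

lemma energyMax_eq (hp : Even p) (e : Ensemble) (hn : 0 < n) :
    energyMax e p n N = √(2 * varianceScale e p n N * (n * Real.log N)) := by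
  have hn' : (0 : ℝ) < n := by exact_mod_cast hn
  have hJ := scalarJ_nonneg e p n N
  have hl : 0 ≤ Real.log N := Real.log_natCast_nonneg N
  rw [energyMax, Real.rpow_add hn', ← Real.sqrt_eq_rpow, rpow_quarter_eq_sqrt hp hn'.le,
    rpow_quarter_eq_sqrt hp (Nat.cast_nonneg N), ← Real.sqrt_mul (by positivity),
    ← Real.sqrt_mul (by positivity), ← Real.sqrt_mul (by positivity), varianceScale]
  congr 1
  ring

lemma energyScale_eq (hp : Even p) (e : Ensemble) (hn : 0 < n) :
    energyScale e p n N = √(varianceScale e p n N) / √(2 * (n * Real.log N)) := by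
  have hn' : (0 : ℝ) < n := by exact_mod_cast hn
  have hJ := scalarJ_nonneg e p n N
  have hl : 0 ≤ Real.log N := Real.log_natCast_nonneg N
  rw [energyScale, Real.rpow_sub hn', ← Real.sqrt_eq_rpow, rpow_quarter_eq_sqrt hp hn'.le,
    rpow_quarter_eq_sqrt hp (Nat.cast_nonneg N), varianceScale,
    Real.sqrt_mul (by positivity) ((N : ℝ) ^ (p / 2)), Real.sqrt_mul hJ,
    show 2 * ((n : ℝ) * Real.log N) = n * (2 * Real.log N) by ring, Real.sqrt_mul hn'.le]
  have : √(n : ℝ) ≠ 0 := (Real.sqrt_pos.2 hn').ne'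
  field_simp

/-- A nonzero energy scale excludes the degenerate cases in which `J` or `log N` vanishes. -/
lemma of_energyScale_ne_zero (hp0 : 0 < p) (hp : Even p) {e : Ensemble}
    (h : energyScale e p n N ≠ 0) : p / 2 ≤ n ∧ 0 < n ∧ 2 ≤ N := by
  have hn : p / 2 ≤ n := by
    by_contra hc
    refine h ?_
    rw [energyScale, scalarJ, leadingJ, Nat.choose_eq_zero_of_lt (by omega)]
    simp
  refine ⟨hn, ?_, ?_⟩
  · obtain ⟨m, rfl⟩ := hp
    omega
  · by_contra hc
    refine h ?_
    have : N = 0 ∨ N = 1 := by omega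
    rcases this with rfl | rfl <;> simp [energyScale]

lemma varianceBound_le (e : Ensemble) (hp0 : 0 < p) (hp : Even p) (hn : p / 2 ≤ n) (hn0 : 0 < n)
    (hN : 0 < N) :
    varianceBound (p / 2) n N ≤ varianceScale e p n N * (1 + (n : ℝ) ^ (p / 2) / N) := by
  have hN' : (0 : ℝ) < N := by exact_mod_cast hN
  have hp1 : p / 2 = p / 2 - 1 + 1 := by obtain ⟨m, rfl⟩ := hp; omega
  have hV := descFactorial_mul_pow_le_varianceScale e hn hn0 hN
  have hD : (n.descFactorial (p / 2) : ℝ) ≤ (n : ℝ) ^ (p / 2) := by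
    exact_mod_cast Nat.descFactorial_le_pow n (p / 2)
  have e1 : varianceBound (p / 2) n N = (n.descFactorial (p / 2) : ℝ) * (N : ℝ) ^ (p / 2) *
      (1 + (n.descFactorial (p / 2) : ℝ) / N) := by
    have : (N : ℝ) ^ (p / 2) = (N : ℝ) ^ (p / 2 - 1) * N := by rw [← pow_succ, ← hp1]
    rw [varianceBound, this]
    field_simp
  rw [e1]
  have h0 : (0 : ℝ) ≤ n.descFactorial (p / 2) := by positivity
  gcongr
  exact (mul_nonneg h0 (by positivity)).trans hV

/-- The exponent of the false alarm probability, for the Laplace parameter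
`β = E_max / (V (1 + ε))`. -/
lemma false_alarm_exponent_le (hp : Even p) (e : Ensemble) (hn : 0 < n) (hN : 2 ≤ N)
    (hV : 0 < varianceScale e p n N) (lam : ℝ) {ε q : ℝ} (hε : 0 ≤ ε) (hε1 : ε ≤ 1)
    (hq : (energyZero p n N lam - energyMax e p n N) / energyScale e p n N = q) (hq0 : 0 ≤ q) :
    n * Real.log N + (energyMax e p n N / (varianceScale e p n N * (1 + ε))) ^ 2 *
      (varianceScale e p n N * (1 + ε)) / 2 -
      energyMax e p n N / (varianceScale e p n N * (1 + ε)) * energyCut e p n N lam ≤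
      ε * (n * Real.log N) - q / 4 := by
  have hl : 0 < (n : ℝ) * Real.log N := by
    have h1 : 0 < Real.log N := Real.log_pos (by exact_mod_cast hN)
    have : (0 : ℝ) < n := by exact_mod_cast hn
    positivity
  have hE := energyMax_eq (N := N) hp e hn
  have hX := energyScale_eq (N := N) hp e hn
  set V := varianceScale e p n N
  set ℓ := (n : ℝ) * Real.log N
  have hE2 : energyMax e p n N ^ 2 = 2 * V * ℓ := by rw [hE, Real.sq_sqrt (by positivity)]
  have hEX : energyMax e p n N * energyScale e p n N = V := by
    rw [hE, hX, show 2 * V * ℓ = V * (2 * ℓ) by ring, Real.sqrt_mul hV.le]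
    have : √(2 * ℓ) ≠ 0 := (Real.sqrt_pos.2 (by positivity)).ne'
    have h3 := Real.mul_self_sqrt hV.le
    field_simp
    linarith
  have hX0 : energyScale e p n N ≠ 0 := fun h => by rw [h, mul_zero] at hEX; exact hV.ne hEX
  have hdiff : energyZero p n N lam = energyMax e p n N + q * energyScale e p n N := by
    rw [← hq]; field_simp; ring
  have hcut : energyMax e p n N * energyCut e p n N lam = 2 * V * ℓ + q * V / 2 := by
    rw [energyCut, hdiff, ← hE2]
    linear_combination (q / 2) * hEX
  have h1ε : 0 < 1 + ε := by linarith
  have main : ℓ + (energyMax e p n N / (V * (1 + ε))) ^ 2 * (V * (1 + ε)) / 2 -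
      energyMax e p n N / (V * (1 + ε)) * energyCut e p n N lam =
      (ε * ℓ - q / 2) / (1 + ε) := by
    have a1 : (energyMax e p n N / (V * (1 + ε))) ^ 2 * (V * (1 + ε)) / 2 = ℓ / (1 + ε) := by
      rw [div_pow, hE2]; field_simp
    have a2 : energyMax e p n N / (V * (1 + ε)) * energyCut e p n N lam =
        (2 * ℓ + q / 2) / (1 + ε) := by
      rw [div_mul_eq_mul_div, hcut]; field_simp
    rw [a1, a2]
    field_simp
    ring
  rw [main, div_le_iff₀ h1ε]
  nlinarith [mul_nonneg hε hl.le, mul_nonneg hε (mul_nonneg hε hl.le), mul_nonneg hε hq0,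
    mul_nonneg (sub_nonneg.2 hε1) hq0]

/-- The energy scale dominates the number of tuples of qudits. -/
lemma descFactorial_le_energyScale (hp0 : 0 < p) (hp : Even p) (e : Ensemble) (hn : p / 2 ≤ n)
    (hn0 : 0 < n) (hN : 2 ≤ N)
    (hδ : (n : ℝ) ^ (p / 2 + 1) * Real.log N / N ≤ 1 / 2) :
    (n.descFactorial (p / 2) : ℝ) ≤ energyScale e p n N := by
  have hN' : (0 : ℝ) < N := by exact_mod_cast (by omega : 0 < N)
  have hN1 : (1 : ℝ) ≤ N := by exact_mod_cast (by omega : 1 ≤ N)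
  have hn' : (0 : ℝ) < n := by exact_mod_cast hn0
  have hl : 0 < Real.log N := Real.log_pos (by exact_mod_cast hN)
  have hp1 : p / 2 ≠ 0 := by obtain ⟨m, rfl⟩ := hp; omega
  have hV := descFactorial_mul_pow_le_varianceScale e hn hn0 (by omega : 0 < N)
  rw [energyScale_eq hp e hn0, le_div_iff₀ (Real.sqrt_pos.2 (by positivity))]
  have hD : (n.descFactorial (p / 2) : ℝ) ≤ (n : ℝ) ^ (p / 2) := by
    exact_mod_cast Nat.descFactorial_le_pow n (p / 2)
  have hD0 : (0 : ℝ) ≤ n.descFactorial (p / 2) := by positivity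
  refine Real.le_sqrt_of_sq_le (le_trans ?_ hV)
  rw [mul_pow, Real.sq_sqrt (by positivity), sq, mul_assoc]
  refine mul_le_mul_of_nonneg_left ?_ hD0
  rw [div_le_iff₀ hN'] at hδ
  calc (n.descFactorial (p / 2) : ℝ) * (2 * (n * Real.log N))
      ≤ (n : ℝ) ^ (p / 2) * (2 * (n * Real.log N)) := by gcongr
    _ = 2 * ((n : ℝ) ^ (p / 2 + 1) * Real.log N) := by ring
    _ ≤ N := by linarith
    _ ≤ (N : ℝ) ^ (p / 2) := le_self_pow₀ hN1 hp1

end Thresholds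

/-- The growth condition on `n` makes the relative errors negligible. -/
lemma tendsto_pow_mul_log_div {h : ℕ} {n : ℕ → ℕ}
    (hn : (fun N : ℕ => (n N : ℝ)) =O[atTop]
      fun N : ℕ => (N : ℝ) ^ (1 / (2 * ((h : ℝ) + 1)))) :
    Tendsto (fun N : ℕ => (n N : ℝ) ^ (h + 1) * Real.log N / N) atTop (𝓝 0) := by
  have h1 : (fun N : ℕ => (n N : ℝ) ^ (h + 1)) =O[atTop] fun N : ℕ => (N : ℝ) ^ (1 / 2 : ℝ) := by
    refine (hn.pow (h + 1)).congr_right fun N => ?_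
    rw [← Real.rpow_natCast, ← Real.rpow_mul (Nat.cast_nonneg N)]
    congr 1
    push_cast
    have : (h : ℝ) + 1 ≠ 0 := by positivity
    field_simp
  have h2 : (fun N : ℕ => Real.log N) =o[atTop] fun N : ℕ => (N : ℝ) ^ (1 / 2 : ℝ) :=
    (isLittleO_log_rpow_atTop (by norm_num : (0 : ℝ) < 1 / 2)).comp_tendsto
      tendsto_natCast_atTop_atTop
  refine ((h1.mul_isLittleO h2).congr_right fun N => ?_).tendsto_div_nhds_zero
  rw [← Real.sqrt_eq_rpow, Real.mul_self_sqrt (Nat.cast_nonneg N)]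

/-- No measurability is needed to pass from a vanishing outer measure to the complement. -/
lemma tendsto_measure_compl {Ω : ℕ → Type*} [∀ N, MeasurableSpace (Ω N)]
    {μ : ∀ N, Measure (Ω N)} [∀ N, IsProbabilityMeasure (μ N)] {A : ∀ N, Set (Ω N)} {b : ℕ → ℝ}
    (hA : ∀ᶠ N in atTop, μ N (A N) ≤ ENNReal.ofReal (b N)) (hb : Tendsto b atTop (𝓝 0)) :
    Tendsto (fun N => μ N (A N)ᶜ) atTop (𝓝 1) := by
  have h0 : Tendsto (fun N => 1 - ENNReal.ofReal (b N)) atTop (𝓝 1) := by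
    have h1 := ENNReal.tendsto_ofReal hb
    rw [ENNReal.ofReal_zero] at h1
    simpa using ENNReal.Tendsto.sub (tendsto_const_nhds (x := (1 : ENNReal))) h1 (Or.inl (by simp))
  refine tendsto_of_tendsto_of_tendsto_of_le_of_le' h0 tendsto_const_nhds ?_
    (.of_forall fun N => prob_le_one)
  filter_upwards [hA] with N hN
  rw [tsub_le_iff_right]
  calc (1 : ENNReal) = μ N ((A N)ᶜ ∪ A N) := by rw [Set.compl_union_self, measure_univ]
    _ ≤ μ N (A N)ᶜ + μ N (A N) := measure_union_le _ _
    _ ≤ _ := by gcongr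

lemma tendsto_const_mul_exp_neg {q : ℕ → ℝ} (hq : Tendsto q atTop atTop) (C : ℝ) {a : ℝ}
    (ha : 0 < a) : Tendsto (fun N => C * Real.exp (-(a * q N))) atTop (𝓝 0) := by
  simpa using (Real.tendsto_exp_neg_atTop_nhds_zero.comp (hq.const_mul_atTop ha)).const_mul C

end SpikedTensor

/-! ### Consistency of the detection step -/

theorem mainTheorem5 (p : ℕ) (hp : Even p) (hp0 : 0 < p) :
    ∃ θ : ℝ, 0 < θ ∧ ∀ θ' : ℝ, (p : ℝ) / 4 < θ' →
      ∀ (e : SpikedTensor.Ensemble) (s : SpikedTensor.Symmetrization) (sec : SpikedTensor.Sector)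
        (n : ℕ → ℕ) (lamBar : ℕ → ℝ)
        (sigLaw : (N : ℕ) → Measure (EuclideanSpace ℝ (Fin N))),
        (∀ N, IsProbabilityMeasure (sigLaw N)) →
        (∀ N : ℕ, ∀ᵐ v ∂(sigLaw N), ‖v‖ = √(N : ℝ)) →
        (fun N : ℕ => (n N : ℝ)) =O[atTop] (fun N : ℕ => (N : ℝ) ^ θ) →
        (fun N : ℕ => (N : ℝ) ^ (-θ')) =O[atTop] lamBar →
        lamBar =O[atTop] (fun N : ℕ => (N : ℝ) ^ (-((p : ℝ) / 4))) →
        Tendsto (fun N : ℕ =>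
            (SpikedTensor.energyZero p (n N) N (lamBar N) - SpikedTensor.energyMax e p (n N) N) /
              SpikedTensor.energyScale e p (n N) N) atTop atTop →
        Tendsto (fun N : ℕ =>
            ((sigLaw N).prod (SpikedTensor.noiseLaw e s p N))
              {ω | ¬ SpikedTensor.ReportsSignal e sec (n N) (lamBar N)
                (SpikedTensor.spikedTensor 0 ω.1 ω.2)}) atTop (𝓝 1) ∧
        Tendsto (fun N : ℕ =>
            ((sigLaw N).prod (SpikedTensor.noiseLaw e s p N))
              {ω | SpikedTensor.ReportsSignal e sec (n N) (lamBar N)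
                (SpikedTensor.spikedTensor (lamBar N) ω.1 ω.2)}) atTop (𝓝 1) := by
  refine ⟨1 / (2 * (((p / 2 : ℕ) : ℝ) + 1)), by positivity, ?_⟩
  intro θ' _ e s sec n lamBar sigLaw hprob hsig hn _ _ hq
  have hnoise := fun N => SpikedTensor.isProbabilityMeasure_noiseLaw e s p N
  have hδ := SpikedTensor.tendsto_pow_mul_log_div hn
  set q : ℕ → ℝ := fun N =>
    (SpikedTensor.energyZero p (n N) N (lamBar N) - SpikedTensor.energyMax e p (n N) N) /
      SpikedTensor.energyScale e p (n N) N with hqdef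
  have hev : ∀ᶠ N in atTop, 0 < q N ∧ (n N : ℝ) ^ (p / 2 + 1) * Real.log N / N ≤ 1 / 2 ∧
      p / 2 ≤ n N ∧ 0 < n N ∧ 3 ≤ N := by
    filter_upwards [hq.eventually_gt_atTop 0, hδ.eventually_le_const (u := 1 / 2) (by norm_num),
      eventually_ge_atTop 3] with N h1 h2 h3
    have hX : SpikedTensor.energyScale e p (n N) N ≠ 0 := by
      intro h0
      simp only [hqdef, h0, div_zero, lt_irrefl] at h1
    obtain ⟨h4, h5, _⟩ := SpikedTensor.of_energyScale_ne_zero hp0 hp hX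
    exact ⟨h1, h2, h4, h5, h3⟩
  have hXpos : ∀ N, 0 ≤ SpikedTensor.energyScale e p (n N) N := fun N => by
    unfold SpikedTensor.energyScale
    positivity
  have hMpos : ∀ N, 0 ≤ SpikedTensor.energyMax e p (n N) N := fun N => by
    unfold SpikedTensor.energyMax
    positivity
  constructor
  · refine SpikedTensor.tendsto_measure_compl (μ := fun N =>
        (sigLaw N).prod (SpikedTensor.noiseLaw e s p N)) (A := fun N =>
      {ω | SpikedTensor.ReportsSignal e sec (n N) (lamBar N)
        (SpikedTensor.spikedTensor 0 ω.1 ω.2)})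
      (b := fun N => 2 * Real.exp 1 * Real.exp (-(1 / 4 * q N))) ?_
      (SpikedTensor.tendsto_const_mul_exp_neg hq _ (by norm_num))
    filter_upwards [hev] with N ⟨hq0, hδN, hnh, hn0, hN⟩
    have hN' : (0 : ℝ) < N := by exact_mod_cast (by omega : 0 < N)
    have hn' : (0 : ℝ) < n N := by exact_mod_cast hn0
    have hn1 : (1 : ℝ) ≤ n N := by exact_mod_cast hn0
    have hV : 0 < SpikedTensor.varianceScale e p (n N) N := by
      refine lt_of_lt_of_le ?_
        (SpikedTensor.descFactorial_mul_pow_le_varianceScale e hnh hn0 (by omega))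
      have : (0 : ℝ) < (n N).descFactorial (p / 2) := by
        exact_mod_cast Nat.descFactorial_pos.2 hnh
      positivity
    -- `log N ≥ 1` makes the relative error `ε` itself at most `1`
    have hlog : 1 ≤ Real.log N := by
      rw [Real.le_log_iff_exp_le hN']
      have : (3 : ℝ) ≤ N := by exact_mod_cast hN
      linarith [Real.exp_one_lt_d9]
    set ε : ℝ := (n N : ℝ) ^ (p / 2) / N with hε
    have hε0 : 0 ≤ ε := by positivity
    have hεl : ε * (n N * Real.log N) ≤ 1 / 2 := by
      refine le_trans (le_of_eq ?_) hδN
      rw [hε]; ring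
    have hε1 : ε ≤ 1 := by
      have : 1 ≤ (n N : ℝ) * Real.log N := one_le_mul_of_one_le_of_one_le hn1 hlog
      nlinarith
    have hcut : 0 ≤ SpikedTensor.energyCut e p (n N) N (lamBar N) := by
      have h1 : 0 ≤ q N * SpikedTensor.energyScale e p (n N) N := mul_nonneg hq0.le (hXpos N)
      have hX : SpikedTensor.energyScale e p (n N) N ≠ 0 := by
        intro h0
        simp only [hqdef, h0, div_zero, lt_irrefl] at hq0
      simp only [hqdef] at h1
      rw [div_mul_cancel₀ _ hX] at h1
      unfold SpikedTensor.energyCut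
      linarith [hMpos N]
    refine (SpikedTensor.measure_reportsSignal_zero_le hp e s sec (n N) (sigLaw N) hcut
      (SpikedTensor.varianceBound_le e hp0 hp hnh hn0 (by omega))
      (β := SpikedTensor.energyMax e p (n N) N /
        (SpikedTensor.varianceScale e p (n N) N * (1 + ε)))
      (div_nonneg (hMpos N) (by positivity))).trans ?_
    refine ENNReal.ofReal_le_ofReal ?_
    have hexp := SpikedTensor.false_alarm_exponent_le hp e hn0 (by omega) hV (lamBar N) hε0 hε1
      rfl hq0.le
    have hNn : (N : ℝ) ^ (n N) = Real.exp (n N * Real.log N) := by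
      rw [Real.exp_nat_mul, Real.exp_log hN']
    rw [hNn, ← hε, mul_assoc, mul_assoc, ← Real.exp_add, ← Real.exp_add, mul_assoc, ← Real.exp_add]
    refine mul_le_mul_of_nonneg_left (Real.exp_le_exp.2 ?_) (by norm_num)
    change _ ≤ _ - q N / 4 at hexp
    linarith
  · have hc := SpikedTensor.tendsto_measure_compl (μ := fun N =>
        (sigLaw N).prod (SpikedTensor.noiseLaw e s p N)) (A := fun N =>
      {ω | ¬ SpikedTensor.ReportsSignal e sec (n N) (lamBar N)
        (SpikedTensor.spikedTensor (lamBar N) ω.1 ω.2)})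
      (b := fun N => 2 * Real.exp (1 / 2) * Real.exp (-(1 / 2 * q N))) ?_
      (SpikedTensor.tendsto_const_mul_exp_neg hq _ (by norm_num))
    · simpa only [Set.compl_ofPred, not_not] using hc
    filter_upwards [hev] with N ⟨hq0, hδN, hnh, hn0, hN⟩
    refine (SpikedTensor.measure_not_reportsSignal_le hp e s sec (lamBar N) (sigLaw N) (hsig N)
      (by omega) hnh).trans ?_
    refine ENNReal.ofReal_le_ofReal ?_
    refine mul_le_mul_of_nonneg_left (Real.exp_le_exp.2 (neg_le_neg ?_)) (by positivity)
    have hD := SpikedTensor.descFactorial_le_energyScale hp0 hp e hnh hn0 (by omega) hδN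
    have hD0 : (0 : ℝ) < (n N).descFactorial (p / 2) := by
      exact_mod_cast Nat.descFactorial_pos.2 hnh
    have hX : 0 < SpikedTensor.energyScale e p (n N) N := hD0.trans_le hD
    have hdiff : SpikedTensor.energyZero p (n N) N (lamBar N) -
        SpikedTensor.energyMax e p (n N) N = q N * SpikedTensor.energyScale e p (n N) N := by
      simp only [hqdef]
      rw [div_mul_cancel₀ _ hX.ne']
    rw [hdiff, le_div_iff₀ hD0]
    nlinarith [mul_le_mul_of_nonneg_left hD hq0.le]
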